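/- Let $c_0>0$, $\alpha\in(0,\frac{\pi}{2}]$, $c=c_0/\sin\alpha$, $\lambda>0$ and $0\le\theta_1<\theta_2<2\pi$. Consider on $\mathbb{R}^2$ the forced mean curvature equation $$-\operatorname{div}\left(\frac{D\phi}{\sqrt{1+|D\phi|^2}}\right)+c_0-\frac{c}{\sqrt{1+|D\phi|^2}}=0. \qquad (1)$$ Let $\mu=\lambda\delta_{\theta_1}+\lambda\delta_{\theta_2}+\mathbf 1_{(\theta_1,\theta_2)}\,d\theta$ on the unit circle $\mathbb{S}^1$ (points being identified with their angles), and put, for $x\in\mathbb{R}^2$, $$\phi_*(x)=-\frac{2}{c_0\sin\alpha}\ln\left(\int_{\mathbb{S}^1}e^{\frac{c_0\cos\alpha}{2}\,x\cdot\nu}\,d\mu(\nu)\right),\qquad \phi_e(x)=\min(p_1(x),p_2(x)),$$ $$p_i(x)=-(\cot\alpha)\,x\cdot\nu_i-\frac{2}{c_0\sin\alpha}\ln\lambda,\qquad \nu_i=(\cos\theta_i,\sin\theta_i),\quad i=1,2.$$ Then there is exactly one radially symmetric $C^2$ solution $\phi_c$ of (1) on $\mathbb{R}^2$ with $D\phi_c(0)=0$,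 $\phi_c(x)=-(\cot\alpha)|x|+o(|x|)$ as $|x|\to\infty$, and $\phi_c(0)=\phi_e(0)=-\frac{2}{c_0\sin\alpha}\ln\lambda$. Writing $x=r(\cos\theta_x,\sin\theta_x)$ with $r=|x|$ and $\theta_x\in[0,2\pi)$ for $x\ne0$, define $$\phi_a(x)=\begin{cases}-\frac{2}{c_0\sin\alpha}\ln\lambda & \text{if } x=0,\\ \min(\phi_c(x),\phi_e(x)) & \text{if } x\neq 0,\ \theta_x\in(\theta_1,\theta_2),\\ \phi_e(x) & \text{otherwise.}\end{cases}$$ Then $\phi_a$ is Lipschitz continuous on $\mathbb{R}^2$ and is a viscosity super-solution of (1) on the whole of $\mathbb{R}^2$; moreover $\phi_a(x)=\phi_*(x)+O(1)$ as $|x|\to\infty$. -/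

import Mathlib

open Real Set Filter Topology MeasureTheory Asymptotics
open scoped NNReal ENNReal

noncomputable section

namespace ForcedMCM

/-- The plane `ℝ²` with its Euclidean norm. -/
abbrev Plane : Type := EuclideanSpace ℝ (Fin 2)

/-- The unit circle of the plane. -/
abbrev Circle1 : Type := Metric.sphere (0 : Plane) 1

/-- The unit vector `(cos θ, sin θ)`. -/
def dir (θ : ℝ) : Plane := !₂[cos θ, sin θ]

theorem norm_dir (θ : ℝ) : ‖dir θ‖ = 1 := by
  simp [dir, EuclideanSpace.norm_eq, Fin.sum_univ_two]

/-- The point of the unit circle with angle `θ`. -/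
def circlePt (θ : ℝ) : Circle1 := ⟨dir θ, by simp [norm_dir]⟩

/-- The Hessian matrix `D²φ(x)`. -/
def hess (φ : Plane → ℝ) (x : Plane) : Matrix (Fin 2) (Fin 2) ℝ :=
  Matrix.of fun i j =>
    fderiv ℝ (fderiv ℝ φ) x (EuclideanSpace.single i 1) (EuclideanSpace.single j 1)

/-- The Hamiltonian of the forced mean curvature equation,
`F(p, M) = - tr M / (1+|p|²)^{1/2} + ⟨M p, p⟩ / (1+|p|²)^{3/2} + c₀ - c / (1+|p|²)^{1/2}`.
For a `C²` function `φ`, `F(Dφ, D²φ)` is the left-hand side of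
`- div (Dφ / √(1+|Dφ|²)) + c₀ - c / √(1+|Dφ|²) = 0`. -/
def hamiltonian (c₀ c : ℝ) (p : Plane) (M : Matrix (Fin 2) (Fin 2) ℝ) : ℝ :=
  - M.trace / √(1 + ‖p‖ ^ 2) + (∑ i, ∑ j, M i j * p i * p j) / √(1 + ‖p‖ ^ 2) ^ 3
    + c₀ - c / √(1 + ‖p‖ ^ 2)

/-- Classical (`C²`) solutions on the whole plane of the forced mean curvature equation. -/
def IsClassicalSolution (c₀ c : ℝ) (φ : Plane → ℝ) : Prop :=
  ContDiff ℝ 2 φ ∧ ∀ x, hamiltonian c₀ c (gradient φ x) (hess φ x) = 0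

/-- Global viscosity super-solutions of the forced mean curvature equation: lower
semicontinuous functions such that `F(Dψ(x), D²ψ(x)) ≥ 0` whenever the `C²` test function `ψ`
is such that `φ - ψ` has a local minimum at `x`. -/
def IsViscositySupersolution (c₀ c : ℝ) (φ : Plane → ℝ) : Prop :=
  LowerSemicontinuous φ ∧
    ∀ (ψ : Plane → ℝ) (x : Plane), ContDiff ℝ 2 ψ → IsLocalMin (fun y => φ y - ψ y) x →
      0 ≤ hamiltonian c₀ c (gradient ψ x) (hess ψ x)

/-- Cone solutions: radially symmetric solutions of the forced mean curvature equation with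
`c = c₀ / sin α`, with vanishing derivative at `0`, asymptotic to the straight cone
`-(cot α) |x|` up to `o(|x|)` at infinity. -/
structure IsConeSolution (c₀ α : ℝ) (φ : Plane → ℝ) : Prop where
  solution : IsClassicalSolution c₀ (c₀ / sin α) φ
  radial : ∀ x y : Plane, ‖x‖ = ‖y‖ → φ x = φ y
  deriv_zero : fderiv ℝ φ 0 = 0
  asymptotic : (fun x => φ x - (-(cot α) * ‖x‖)) =o[Bornology.cobounded Plane] fun x => ‖x‖

/-- The sub-solution `φ_*` attached to a measure `μ` on the unit circle. -/
def subSol (c₀ α : ℝ) (μ : Measure Circle1) (x : Plane) : ℝ :=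
  -(2 / (c₀ * sin α)) *
    log (∫ ν : Circle1, exp (c₀ * cos α / 2 * inner ℝ x (ν : Plane)) ∂μ)

/-- The measure `lam δ_{θ₁} + lam δ_{θ₂} + 1_{(θ₁,θ₂)} dθ` on the unit circle. -/
def arcMeasure (lam θ₁ θ₂ : ℝ) : Measure Circle1 :=
  ENNReal.ofReal lam • Measure.dirac (circlePt θ₁)
    + ENNReal.ofReal lam • Measure.dirac (circlePt θ₂)
    + (volume.restrict (Ioo θ₁ θ₂)).map circlePt

/-- The affine function `-(cot α) x·(cos θ, sin θ) - 2/(c₀ sin α) ln lam`. -/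
def planeFun (c₀ α lam θ : ℝ) (x : Plane) : ℝ :=
  -(cot α) * inner ℝ x (dir θ) - 2 / (c₀ * sin α) * log lam

/-- The edge function `φ_e`. -/
def edgeFun (c₀ α lam₁ lam₂ θ₁ θ₂ : ℝ) (x : Plane) : ℝ :=
  min (planeFun c₀ α lam₁ θ₁ x) (planeFun c₀ α lam₂ θ₂ x)

/-- The open sector of the points `r (cos θ, sin θ)` with `r > 0` and `θ₁ < θ < θ₂`. -/
def sector (θ₁ θ₂ : ℝ) : Set Plane :=
  {x | ∃ r : ℝ, 0 < r ∧ ∃ θ ∈ Ioo θ₁ θ₂, x = r • dir θ}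

open Classical in
/-- The arc function `φ_a`, built from the cone solution `φc` and the edge function. -/
def arcFun (c₀ α lam θ₁ θ₂ : ℝ) (φc : Plane → ℝ) (x : Plane) : ℝ :=
  if x = 0 then -(2 / (c₀ * sin α)) * log lam
  else if x ∈ sector θ₁ θ₂ then min (φc x) (edgeFun c₀ α lam lam θ₁ θ₂ x)
  else edgeFun c₀ α lam lam θ₁ θ₂ x

end ForcedMCM

end

open ForcedMCM

/-! Cone solutions. For a radial function with slope `-v / √(1 - v²)`, where `v` is the sine of the
inclination, equation (1) becomes `(r v)' = r (c √(1 - v²) - c₀)`. This has a solution through the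
singular point `r = 0` by a weighted contraction (`exists_singular_ode`). It stays in `[0, cos α]`,
since the force vanishes at `v = cos α`, so the cone is Lipschitz with constant `cot α`. Uniqueness
holds because the singular term `-v / r` is dissipative (`slope_unique`). Integrating the slope
gives `φ_c = -(cot α) |x| + ln |x| / (c₀ sin α) + O(1)` (`radial_profile_log_expansion`).

Super-solution. The planes `p_i` and `φ_c` are classical solutions. At each point one of the three
touches `φ_a` from above, so ellipticity applies (`IsClassicalSolution.nonneg_of_touching`). The
pieces agree on the boundary rays: there `φ_c ≥ φ_c(0) - (cot α) |x| = p_i`.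

Distance to `φ_*`. Apply `t ↦ exp (-(c₀ sin α / 2) t)`. The planes become the two Dirac terms of the
integral, `φ_c` becomes `exp (k r) / √r` up to constant factors, with `k = c₀ cos α / 2`, and minima
become maxima, comparable with sums. Laplace's method shows that the arc integral is also of size
`exp (k r) / √r` inside the sector; outside, the Dirac terms dominate it. The two exponentials
therefore have bounded ratio (`exists_arcFun_comparison`), and logarithms give `O(1)`. -/

namespace ForcedMCM

/-! ### Calculus of radial functions -/

/-- The Euclidean inner product of the plane as a bilinear map. -/
noncomputable def dotL : Plane →L[ℝ] Plane →L[ℝ] ℝ :=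
  LinearMap.toContinuousLinearMap
    { toFun := fun x => innerSL ℝ x
      map_add' := fun x y => by simp
      map_smul' := fun a x => by simp }

@[simp] theorem dotL_apply (x y : Plane) : dotL x y = inner ℝ x y := rfl

theorem dotL_eq_innerSL (x : Plane) : dotL x = innerSL ℝ x := rfl

theorem norm_dotL_apply (x : Plane) : ‖dotL x‖ = ‖x‖ := by
  rw [dotL_eq_innerSL, innerSL_apply_norm]

theorem inner_plane (x y : Plane) : inner ℝ x y = x 0 * y 0 + x 1 * y 1 := by
  simp [PiLp.inner_apply, Fin.sum_univ_two, mul_comm]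

theorem norm_sq_plane (x : Plane) : ‖x‖ ^ 2 = x 0 ^ 2 + x 1 ^ 2 := by
  rw [EuclideanSpace.norm_sq_eq, Fin.sum_univ_two]; simp

theorem hasFDerivAt_norm_plane {x : Plane} (hx : x ≠ 0) :
    HasFDerivAt (fun y : Plane => ‖y‖) (‖x‖⁻¹ • dotL x) x := by
  have h := ((hasStrictFDerivAt_norm_sq x).hasFDerivAt).sqrt
    (pow_ne_zero 2 (norm_ne_zero_iff.2 hx))
  simp only [Real.sqrt_sq (norm_nonneg _)] at h
  refine h.congr_fderiv ?_
  have : ‖x‖ ≠ 0 := norm_ne_zero_iff.2 hx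
  ext y
  simp
  field_simp

theorem gradient_eq_of_hasFDerivAt {φ : Plane → ℝ} {p x : Plane}
    (h : HasFDerivAt φ (dotL p) x) : gradient φ x = p :=
  HasGradientAt.gradient (f := φ) (hasGradientAt_iff_hasFDerivAt.2 h)

/-- The Hessian (as a bilinear map) of a radial function with `Dφ(x) = m(|x|) x` and
`r m'(r) = n(r)`. -/
noncomputable def radialHess (m n : ℝ) (x : Plane) : Plane →L[ℝ] Plane →L[ℝ] ℝ :=
  m • dotL + (n / ‖x‖ ^ 2) • (dotL x).smulRight (dotL x)

theorem radialHess_apply (m n : ℝ) (x y z : Plane) :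
    radialHess m n x y z = m * inner ℝ y z + n / ‖x‖ ^ 2 * (inner ℝ x y * inner ℝ x z) := by
  simp [radialHess]

theorem hasFDerivAt_fderiv_of_radial {φ : Plane → ℝ} {m : ℝ → ℝ} {n : ℝ} {x : Plane}
    (hx : x ≠ 0) (hφ : ∀ᶠ y in 𝓝 x, fderiv ℝ φ y = m ‖y‖ • dotL y)
    (hm : HasDerivAt m (n / ‖x‖) ‖x‖) :
    HasFDerivAt (fderiv ℝ φ) (radialHess (m ‖x‖) n x) x := by
  have h1 : HasFDerivAt (fun y : Plane => m ‖y‖) ((n / ‖x‖) • (‖x‖⁻¹ • dotL x)) x :=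
    hm.comp_hasFDerivAt x (hasFDerivAt_norm_plane hx)
  have h2 := h1.smul dotL.hasFDerivAt
  refine (h2.congr_of_eventuallyEq hφ).congr_fderiv ?_
  have : ‖x‖ ≠ 0 := norm_ne_zero_iff.2 hx
  ext y z
  simp [radialHess_apply]
  field_simp

/-- Continuity of `m` suffices at the origin, because `m(|y|) y - m(0) y = o(|y|)`. -/
theorem hasFDerivAt_fderiv_of_radial_zero {φ : Plane → ℝ} {m : ℝ → ℝ}
    (hφ : ∀ y, fderiv ℝ φ y = m ‖y‖ • dotL y) (hm : Continuous m) :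
    HasFDerivAt (fderiv ℝ φ) (radialHess (m ‖(0 : Plane)‖) 0 0) 0 := by
  rw [hasFDerivAt_iff_isLittleO_nhds_zero]
  have h : Tendsto (fun y : Plane => m ‖y‖ - m 0) (𝓝 0) (𝓝 0) := by
    have : Continuous fun y : Plane => m ‖y‖ - m 0 := by fun_prop
    simpa using this.tendsto 0
  have h2 : (fun y : Plane => (m ‖y‖ - m 0) • dotL y) =o[𝓝 0] fun y => y := by
    have h3 : (fun y : Plane => m ‖y‖ - m 0) =o[𝓝 0] fun _ => (1 : ℝ) :=
      (isLittleO_one_iff ℝ).2 h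
    have h4 : (fun y : Plane => dotL y) =O[𝓝 0] fun y => y := dotL.isBigO_id _
    have := h3.smul_isBigO h4
    simpa using this
  refine h2.congr_left fun y => ?_
  ext z
  simp [hφ, radialHess_apply]
  ring

theorem hess_of_hasFDerivAt_radial {φ : Plane → ℝ} {m n : ℝ} {x : Plane}
    (h : HasFDerivAt (fderiv ℝ φ) (radialHess m n x) x) (i j : Fin 2) :
    hess φ x i j = m * (if i = j then 1 else 0) + n / ‖x‖ ^ 2 * (x i * x j) := by
  simp only [hess, Matrix.of_apply, h.fderiv, radialHess_apply]
  fin_cases i <;> fin_cases j <;> simp [inner_plane]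

/-- `M` has eigenvalue `m + n` along `x` and `m` across it. At the origin the quotient `n / ‖x‖ ^ 2`
is `0` by convention, so the trace `2 m + n` is right there only when `n = 0`. -/
theorem hamiltonian_radial (c₀ c m n : ℝ) {x : Plane} {M : Matrix (Fin 2) (Fin 2) ℝ}
    (hM : ∀ i j, M i j = m * (if i = j then 1 else 0) + n / ‖x‖ ^ 2 * (x i * x j))
    (hn : x = 0 → n = 0) :
    hamiltonian c₀ c (m • x) M =
      - (2 * m + n) / √(1 + m ^ 2 * ‖x‖ ^ 2)
        + m ^ 2 * ‖x‖ ^ 2 * (m + n) / √(1 + m ^ 2 * ‖x‖ ^ 2) ^ 3 + c₀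
        - c / √(1 + m ^ 2 * ‖x‖ ^ 2) := by
  have h1 : ‖m • x‖ ^ 2 = m ^ 2 * ‖x‖ ^ 2 := by
    rw [norm_smul, mul_pow]; simp
  have hx := norm_sq_plane x
  have htr : M.trace = 2 * m + n := by
    rw [Matrix.trace_fin_two, hM, hM]
    by_cases h0 : x = 0
    · simp [h0, hn h0]; ring
    · have : ‖x‖ ^ 2 ≠ 0 := pow_ne_zero 2 (norm_ne_zero_iff.2 h0)
      simp only [if_true]
      field_simp
      rw [hx]; ring
  have hq : (∑ i, ∑ j, M i j * (m • x) i * (m • x) j) = m ^ 2 * ‖x‖ ^ 2 * (m + n) := by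
    simp only [hM, Fin.sum_univ_two, PiLp.smul_apply, smul_eq_mul]
    by_cases h0 : x = 0
    · simp [h0]
    · have : ‖x‖ ^ 2 ≠ 0 := pow_ne_zero 2 (norm_ne_zero_iff.2 h0)
      clear h1 htr hM
      generalize ‖x‖ ^ 2 = N at *
      simp
      field_simp
      rw [hx]; ring
  unfold hamiltonian
  rw [h1, htr, hq]

/-- A `C²` criterion for radial functions. -/
theorem contDiff_two_of_radial {φ : Plane → ℝ} {m n : ℝ → ℝ} (hm : Continuous m)
    (hn : Continuous n) (hn0 : n 0 = 0) (hmn : ∀ r, 0 < r → HasDerivAt m (n r / r) r)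
    (hφ : ∀ y, HasFDerivAt φ (m ‖y‖ • dotL y) y) :
    ContDiff ℝ 2 φ ∧
      ∀ x, HasFDerivAt (fderiv ℝ φ) (radialHess (m ‖x‖) (n ‖x‖) x) x := by
  have hφ' : ∀ y, fderiv ℝ φ y = m ‖y‖ • dotL y := fun y => (hφ y).fderiv
  have key : ∀ x, HasFDerivAt (fderiv ℝ φ) (radialHess (m ‖x‖) (n ‖x‖) x) x := by
    intro x
    by_cases hx : x = 0
    · subst hx
      have := hasFDerivAt_fderiv_of_radial_zero hφ' hm
      simpa [hn0] using this
    · exact hasFDerivAt_fderiv_of_radial hx (Eventually.of_forall hφ')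
        (hmn _ (norm_pos_iff.2 hx))
  refine ⟨?_, key⟩
  have h2 : (2 : WithTop ℕ∞) = 1 + 1 := by norm_num
  rw [h2, contDiff_succ_iff_fderiv]
  refine ⟨fun x => (hφ x).differentiableAt, by simp, ?_⟩
  rw [contDiff_one_iff_fderiv]
  refine ⟨fun x => (key x).differentiableAt, ?_⟩
  have : fderiv ℝ (fderiv ℝ φ) = fun x : Plane => radialHess (m ‖x‖) (n ‖x‖) x := by
    funext x; exact (key x).fderiv
  rw [this]
  unfold radialHess
  refine Continuous.add (by fun_prop) ?_
  rw [continuous_iff_continuousAt]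
  intro x
  by_cases hx : x = 0
  · subst hx
    have h0 : (n ‖(0 : Plane)‖ / ‖(0 : Plane)‖ ^ 2) • (dotL 0).smulRight (dotL 0) = 0 := by
      ext; simp
    rw [ContinuousAt, h0]
    rw [tendsto_zero_iff_norm_tendsto_zero]
    have h3 : Tendsto (fun x : Plane => |n ‖x‖|) (𝓝 0) (𝓝 0) := by
      have : Continuous fun y : Plane => |n ‖y‖| := by fun_prop
      simpa [hn0] using this.tendsto 0
    -- The rank-one term has norm at most `|n(|y|)|`, which tends to `n 0 = 0`.
    refine squeeze_zero (fun _ => norm_nonneg _) (fun y => ?_) h3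
    rw [norm_smul, ContinuousLinearMap.norm_smulRight_apply, norm_dotL_apply]
    by_cases hy : y = 0
    · simp [hy]
    · have : ‖y‖ ≠ 0 := norm_ne_zero_iff.2 hy
      rw [Real.norm_eq_abs, abs_div, abs_of_nonneg (sq_nonneg ‖y‖)]
      field_simp
      exact le_rfl
  · have h4 : ‖x‖ ^ 2 ≠ 0 := pow_ne_zero 2 (norm_ne_zero_iff.2 hx)
    have h5 : ContinuousAt (fun x : Plane => n ‖x‖ / ‖x‖ ^ 2) x :=
      ContinuousAt.div (by fun_prop) (by fun_prop) h4
    have h6 : Continuous fun x : Plane => (dotL x).smulRight (dotL x) := by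
      have : Continuous fun x : Plane =>
        ContinuousLinearMap.smulRightL ℝ Plane (Plane →L[ℝ] ℝ) (dotL x) (dotL x) := by fun_prop
      exact this
    exact h5.smul h6.continuousAt

/-! ### Uniqueness of radial solutions -/

/-- The slope of a radial classical solution solves a singular ODE. -/
theorem exists_slope_of_radial_solution {c₀ c : ℝ} {φ : Plane → ℝ}
    (hsol : IsClassicalSolution c₀ c φ) (hrad : ∀ x y : Plane, ‖x‖ = ‖y‖ → φ x = φ y)
    (h0 : fderiv ℝ φ 0 = 0) :
    ∃ u s : ℝ → ℝ, (∀ x, φ x = u ‖x‖) ∧ (∀ r, HasDerivAt u (s r) r) ∧ Continuous s ∧ s 0 = 0 ∧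
      ∀ r, 0 < r → HasDerivAt s
        ((1 + s r ^ 2) * (c₀ * √(1 + s r ^ 2) - c - s r / r)) r := by
  obtain ⟨hC, hF⟩ := hsol
  set u : ℝ → ℝ := fun r => φ (r • dir 0) with hu
  have huC : ContDiff ℝ 2 u := by
    have : ContDiff ℝ 2 fun r : ℝ => r • dir 0 := contDiff_id.smul contDiff_const
    exact hC.comp this
  have hφu : ∀ x, φ x = u ‖x‖ := fun x => hrad _ _ (by simp [norm_smul, norm_dir])
  have hud : ∀ r, HasDerivAt u (deriv u r) r := fun r =>
    (huC.differentiable (by norm_num) r).hasDerivAt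
  have hsC : ContDiff ℝ 1 (deriv u) := by
    have := (contDiff_succ_iff_deriv (n := 1) (f := u)).1 (by rw [one_add_one_eq_two]; exact huC)
    exact this.2.2
  refine ⟨u, deriv u, hφu, hud, hsC.continuous, ?_, fun r hr => ?_⟩
  · have h1 : HasDerivAt (fun r : ℝ => r • dir 0) (dir 0) 0 := by
      simpa using (hasDerivAt_id (0 : ℝ)).smul_const (dir 0)
    have h2 : HasFDerivAt φ (fderiv ℝ φ 0) ((fun r : ℝ => r • dir 0) 0) := by
      simpa using (hC.differentiable (by norm_num) 0).hasFDerivAt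
    have := h2.comp_hasDerivAt 0 h1
    rw [h0] at this
    have h3 : deriv u 0 = _ := this.deriv
    simpa using h3
  · have hsd : HasDerivAt (deriv u) (deriv (deriv u) r) r :=
      (hsC.differentiable (by norm_num) r).hasDerivAt
    set s := deriv u
    set s' := deriv s r
    set x : Plane := r • dir 0 with hx
    have hxr : ‖x‖ = r := by rw [hx, norm_smul, norm_dir, Real.norm_eq_abs, abs_of_pos hr, mul_one]
    have hx0 : x ≠ 0 := by rw [← norm_pos_iff, hxr]; exact hr
    have hφd : ∀ y : Plane, y ≠ 0 → HasFDerivAt φ ((s ‖y‖ / ‖y‖) • dotL y) y := by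
      intro y hy
      have : HasFDerivAt (fun y : Plane => u ‖y‖) (s ‖y‖ • (‖y‖⁻¹ • dotL y)) y :=
        (hud _).comp_hasFDerivAt y (hasFDerivAt_norm_plane hy)
      rw [smul_smul, ← div_eq_mul_inv] at this
      exact this.congr_of_eventuallyEq (Eventually.of_forall hφu)
    -- With `m = s / r` one has `r m' = s' - s / r`, which is the `n` of `radialHess`.
    have hm : HasDerivAt (fun r => s r / r) ((s' - s r / r) / r) r := by
      have := hsd.div (hasDerivAt_id r) hr.ne'
      refine this.congr_deriv ?_
      simp only [id]
      field_simp
    have hH : HasFDerivAt (fderiv ℝ φ) (radialHess (s ‖x‖ / ‖x‖) (s' - s r / r) x) x := by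
      refine hasFDerivAt_fderiv_of_radial (m := fun r => s r / r) hx0 ?_ (by rw [hxr]; exact hm)
      filter_upwards [isOpen_ne.mem_nhds hx0] with y hy using (hφd y hy).fderiv
    have hg : gradient φ x = (s ‖x‖ / ‖x‖) • x := by
      refine gradient_eq_of_hasFDerivAt ?_
      have := hφd x hx0
      rwa [← map_smul] at this
    have hE := hF x
    rw [hg, hamiltonian_radial c₀ c _ _ (hess_of_hasFDerivAt_radial hH) (fun h => absurd h hx0),
      hxr] at hE
    have e1 : (s r / r) ^ 2 * r ^ 2 = s r ^ 2 := by field_simp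
    rw [e1] at hE
    have hW : √(1 + s r ^ 2) ^ 2 = 1 + s r ^ 2 := Real.sq_sqrt (by positivity)
    have hWp : 0 < √(1 + s r ^ 2) := Real.sqrt_pos.2 (by positivity)
    refine hsd.congr_deriv ?_
    generalize √(1 + s r ^ 2) = W at *
    have e2 : s r / r + (s' - s r / r) = s' := by ring
    have e3 : 2 * (s r / r) + (s' - s r / r) = s' + s r / r := by ring
    rw [e2, e3] at hE
    generalize s r / r = m at *
    generalize s r = t at *
    field_simp at hE
    rw [← hW]
    linear_combination -hE - s' * hW

/-- Uniqueness for the ODE of the slope. -/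
theorem slope_unique {c₀ c : ℝ} {s₁ s₂ : ℝ → ℝ} (h₁ : Continuous s₁) (h₂ : Continuous s₂)
    (h₁0 : s₁ 0 = 0) (h₂0 : s₂ 0 = 0)
    (hd₁ : ∀ r, 0 < r → HasDerivAt s₁
      ((1 + s₁ r ^ 2) * (c₀ * √(1 + s₁ r ^ 2) - c - s₁ r / r)) r)
    (hd₂ : ∀ r, 0 < r → HasDerivAt s₂
      ((1 + s₂ r ^ 2) * (c₀ * √(1 + s₂ r ^ 2) - c - s₂ r / r)) r)
    {R : ℝ} (hR : 0 ≤ R) : s₁ R = s₂ R := by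
  -- `G` is the nonsingular part of the equation. It is Lipschitz on the compact range of the two
  -- slopes, and its constant `L` sets the Gronwall weight in `f`.
  set G : ℝ → ℝ := fun s => (1 + s ^ 2) * (c₀ * √(1 + s ^ 2) - c) with hG
  have hGC : ContDiff ℝ 1 G := by
    have : ContDiff ℝ 1 fun s : ℝ => √(1 + s ^ 2) :=
      ContDiff.sqrt (by fun_prop) (fun s => by positivity)
    fun_prop
  obtain ⟨B₁, hB₁⟩ := (isCompact_Icc (a := 0) (b := R)).exists_bound_of_continuousOn
    h₁.continuousOn
  obtain ⟨B₂, hB₂⟩ := (isCompact_Icc (a := 0) (b := R)).exists_bound_of_continuousOn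
    h₂.continuousOn
  set B := max B₁ B₂
  obtain ⟨L, hL⟩ := (hGC.contDiffOn (s := Icc (-B) B)).exists_lipschitzOnWith one_ne_zero
    (convex_Icc _ _) isCompact_Icc
  have hm₁ : ∀ r ∈ Icc 0 R, s₁ r ∈ Icc (-B) B := fun r hr =>
    abs_le.1 ((hB₁ r hr).trans (le_max_left _ _))
  have hm₂ : ∀ r ∈ Icc 0 R, s₂ r ∈ Icc (-B) B := fun r hr =>
    abs_le.1 ((hB₂ r hr).trans (le_max_right _ _))
  set f : ℝ → ℝ := fun r => (s₁ r - s₂ r) ^ 2 * exp (-(2 * L) * r) with hf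
  have hanti : AntitoneOn f (Icc 0 R) := by
    have hder : ∀ r ∈ interior (Icc 0 R), HasDerivAt f
        ((2 * (s₁ r - s₂ r) * ((1 + s₁ r ^ 2) * (c₀ * √(1 + s₁ r ^ 2) - c - s₁ r / r)
          - (1 + s₂ r ^ 2) * (c₀ * √(1 + s₂ r ^ 2) - c - s₂ r / r))
          - 2 * L * (s₁ r - s₂ r) ^ 2) * exp (-(2 * L) * r)) r := by
      intro r hr
      rw [interior_Icc] at hr
      have e1 := ((hd₁ r hr.1).sub (hd₂ r hr.1)).pow 2
      have e2 : HasDerivAt (fun r : ℝ => exp (-(2 * (L : ℝ)) * r))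
          (exp (-(2 * (L : ℝ)) * r) * (-(2 * L))) r := by
        simpa using ((hasDerivAt_id r).const_mul (-(2 * (L : ℝ)))).exp
      refine (e1.mul e2).congr_deriv ?_
      simp only [Pi.sub_apply, Pi.pow_apply]
      push_cast
      ring
    refine antitoneOn_of_deriv_nonpos (convex_Icc _ _) (by fun_prop)
      (fun r hr => (hder r hr).differentiableAt.differentiableWithinAt) fun r hr => ?_
    rw [(hder r hr).deriv]
    rw [interior_Icc] at hr
    have hr' : r ∈ Icc 0 R := Ioo_subset_Icc_self hr
    refine mul_nonpos_of_nonpos_of_nonneg ?_ (exp_pos _).le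
    have hlip := hL.dist_le_mul _ (hm₁ r hr') _ (hm₂ r hr')
    rw [Real.dist_eq, Real.dist_eq] at hlip
    have h3 : (s₁ r - s₂ r) * (G (s₁ r) - G (s₂ r)) ≤ L * (s₁ r - s₂ r) ^ 2 := by
      calc _ ≤ |(s₁ r - s₂ r) * (G (s₁ r) - G (s₂ r))| := le_abs_self _
        _ = |s₁ r - s₂ r| * |G (s₁ r) - G (s₂ r)| := abs_mul _ _
        _ ≤ |s₁ r - s₂ r| * (L * |s₁ r - s₂ r|) := by gcongr
        _ = L * (s₁ r - s₂ r) ^ 2 := by rw [← sq_abs (s₁ r - s₂ r)]; ring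
    -- The singular term has the good sign because `s ↦ s + s³` is increasing, so no control of `1 /
    -- r` near `0` is needed.
    have h4 : 0 ≤ (s₁ r - s₂ r) * ((1 + s₁ r ^ 2) * (s₁ r / r) - (1 + s₂ r ^ 2) * (s₂ r / r)) := by
      have : (s₁ r - s₂ r) * ((1 + s₁ r ^ 2) * (s₁ r / r) - (1 + s₂ r ^ 2) * (s₂ r / r))
          = (s₁ r - s₂ r) ^ 2 * (1 + ((s₁ r) ^ 2 + s₁ r * s₂ r + (s₂ r) ^ 2)) / r := by ring
      rw [this]
      have h5 : 0 ≤ (s₁ r) ^ 2 + s₁ r * s₂ r + (s₂ r) ^ 2 := by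
        nlinarith [sq_nonneg (s₁ r + s₂ r), sq_nonneg (s₁ r), sq_nonneg (s₂ r)]
      have := hr.1
      positivity
    simp only [hG] at h3
    linarith
  have hle := hanti (left_mem_Icc.2 hR) (right_mem_Icc.2 hR) hR
  have h6 : (s₁ R - s₂ R) ^ 2 ≤ 0 := by
    have : (s₁ R - s₂ R) ^ 2 * exp (-(2 * L) * R) ≤ 0 := by
      simpa [hf, h₁0, h₂0] using hle
    exact nonpos_of_mul_nonpos_left this (exp_pos _)
  have := pow_eq_zero_iff (two_ne_zero) |>.1 (le_antisymm h6 (sq_nonneg _))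
  linarith

theorem radial_solution_unique {c₀ c : ℝ} {φ₁ φ₂ : Plane → ℝ}
    (hsol₁ : IsClassicalSolution c₀ c φ₁) (hrad₁ : ∀ x y : Plane, ‖x‖ = ‖y‖ → φ₁ x = φ₁ y)
    (h₁ : fderiv ℝ φ₁ 0 = 0)
    (hsol₂ : IsClassicalSolution c₀ c φ₂) (hrad₂ : ∀ x y : Plane, ‖x‖ = ‖y‖ → φ₂ x = φ₂ y)
    (h₂ : fderiv ℝ φ₂ 0 = 0) (h0 : φ₁ 0 = φ₂ 0) : φ₁ = φ₂ := by
  obtain ⟨u₁, s₁, hu₁, hd₁, hc₁, hz₁, hs₁⟩ := exists_slope_of_radial_solution hsol₁ hrad₁ h₁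
  obtain ⟨u₂, s₂, hu₂, hd₂, hc₂, hz₂, hs₂⟩ := exists_slope_of_radial_solution hsol₂ hrad₂ h₂
  funext x
  rw [hu₁, hu₂]
  have key : ∀ r ∈ Icc 0 ‖x‖, u₁ r = u₂ r := by
    refine eq_of_has_deriv_right_eq (f' := s₁) (fun r _ => (hd₁ r).hasDerivWithinAt)
      (fun r hr => ?_) (fun r _ => (hd₁ r).continuousAt.continuousWithinAt)
      (fun r _ => (hd₂ r).continuousAt.continuousWithinAt) (by simpa [hu₁, hu₂] using h0)
    rw [slope_unique hc₁ hc₂ hz₁ hz₂ hs₁ hs₂ hr.1]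
    exact (hd₂ r).hasDerivWithinAt
  exact key _ (right_mem_Icc.2 (norm_nonneg _))

/-! ### Existence for the singular radial ODE -/

theorem abs_integral_mul_le {f g : ℝ → ℝ} (hg : Continuous g) (h : ∀ t ∈ Ioc (0 : ℝ) 1, |f t| ≤ g t) :
    |∫ t in (0 : ℝ)..1, f t| ≤ ∫ t in (0 : ℝ)..1, g t := by
  rw [← Real.norm_eq_abs]
  exact intervalIntegral.norm_integral_le_of_norm_le zero_le_one
    (Eventually.of_forall h) (hg.intervalIntegrable _ _)

/-- Solvability of `v' + v / r = H(v)`, `v(0) = 0`, for a bounded Lipschitz nonlinearity. -/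
theorem exists_singular_ode {H : ℝ → ℝ} {K : ℝ≥0} (hH : LipschitzWith K H) {B : ℝ}
    (hB : ∀ v, |H v| ≤ B) :
    ∃ v Q : ℝ → ℝ, Continuous v ∧ Continuous Q ∧ (∀ r, v r = |r| * Q r) ∧
      (∀ r, Q r = ∫ t in (0 : ℝ)..1, t * H (v (t * r))) ∧
      ∀ r, 0 < r → HasDerivAt v (H (v r) - Q r) r := by
  have hB0 : 0 ≤ B := (abs_nonneg _).trans (hB 0)
  have hHc := hH.continuous
  -- The unknown is the bounded function `w = exp (-L |r|) v`. Integrating the weight gains a factor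
  -- `1 / L`, so the contraction constant is `K / L < 1`. The bound `L ≥ 1` also gives `exp (-L |r|)
  -- |r| ≤ 1`.
  set L : ℝ := K + 1 with hL
  have hL1 : 1 ≤ L := by have := K.coe_nonneg; linarith
  have hL0 : 0 < L := by linarith
  -- The substitution `s = t r` turns `(1 / r) ∫₀ʳ s H(v(s)) ds` into `r ∫₀¹ t H(v(t r)) dt`, which
  -- is regular at `r = 0`.
  let I : BoundedContinuousFunction ℝ ℝ → ℝ → ℝ := fun w r =>
    ∫ t in (0 : ℝ)..1, t * H (exp (L * |t * r|) * w (t * r))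
  have hIc : ∀ w, Continuous (I w) := by
    intro w
    have hw := w.continuous
    apply intervalIntegral.continuous_parametric_intervalIntegral_of_continuous'
      (f := fun r t => t * H (exp (L * |t * r|) * w (t * r)))
    fun_prop
  have hEb : ∀ r : ℝ, exp (-(L * |r|)) * |r| ≤ 1 := by
    intro r
    rw [Real.exp_neg, inv_mul_le_iff₀ (exp_pos _), mul_one]
    have h1 := Real.add_one_le_exp (L * |r|)
    have h2 : |r| ≤ L * |r| := le_mul_of_one_le_left (abs_nonneg _) hL1
    linarith
  have hIb : ∀ w r, |I w r| ≤ B := by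
    intro w r
    refine (abs_integral_mul_le (g := fun _ => B) continuous_const ?_).trans (by simp)
    intro t ht
    rw [abs_mul, abs_of_pos ht.1]
    calc t * |H _| ≤ 1 * B := by gcongr; exacts [ht.2, hB _]
      _ = B := one_mul B
  let T : BoundedContinuousFunction ℝ ℝ → BoundedContinuousFunction ℝ ℝ := fun w =>
    BoundedContinuousFunction.ofNormedAddCommGroup
      (fun r => exp (-(L * |r|)) * |r| * I w r) (by have := hIc w; fun_prop) B (by
        intro r
        rw [Real.norm_eq_abs, abs_mul, abs_of_nonneg (by positivity)]
        calc _ ≤ 1 * B := by gcongr; exacts [hEb r, hIb w r]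
          _ = B := one_mul B)
  have hTr : ∀ w r, T w r = exp (-(L * |r|)) * |r| * I w r := fun w r => rfl
  have hcontr : ContractingWith (Real.toNNReal (K / L)) T := by
    have hKL : K / L < 1 := by rw [div_lt_one hL0]; linarith
    refine ⟨by rw [Real.toNNReal_lt_one]; exact hKL, LipschitzWith.of_dist_le_mul fun w₁ w₂ => ?_⟩
    rw [Real.coe_toNNReal _ (by positivity)]
    set d := dist w₁ w₂ with hd
    have hd0 : 0 ≤ d := dist_nonneg
    refine (BoundedContinuousFunction.dist_le (by positivity)).2 fun r => ?_
    rw [hTr, hTr, Real.dist_eq, ← mul_sub, abs_mul, abs_of_nonneg (by positivity)]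
    have h1 : |I w₁ r - I w₂ r| ≤ ∫ t in (0 : ℝ)..1, K * d * exp (L * |r| * t) := by
      have hsub : I w₁ r - I w₂ r = ∫ t in (0 : ℝ)..1,
          (t * H (exp (L * |t * r|) * w₁ (t * r)) - t * H (exp (L * |t * r|) * w₂ (t * r))) := by
        have hw₁ := w₁.continuous
        have hw₂ := w₂.continuous
        rw [intervalIntegral.integral_sub]
        · exact Continuous.intervalIntegrable (by fun_prop) _ _
        · exact Continuous.intervalIntegrable (by fun_prop) _ _
      rw [hsub]
      refine abs_integral_mul_le (by fun_prop) fun t ht => ?_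
      rw [← mul_sub, abs_mul, abs_of_pos ht.1]
      have h2 := hH.dist_le_mul (exp (L * |t * r|) * w₁ (t * r)) (exp (L * |t * r|) * w₂ (t * r))
      rw [Real.dist_eq, Real.dist_eq, ← mul_sub, abs_mul (exp _), abs_of_pos (exp_pos _)] at h2
      have h3 : |w₁ (t * r) - w₂ (t * r)| ≤ d := by
        rw [← Real.dist_eq]; exact BoundedContinuousFunction.dist_coe_le_dist _
      have h4 : L * |t * r| = L * |r| * t := by rw [abs_mul, abs_of_pos ht.1]; ring
      rw [h4] at h2
      rw [h4]
      calc _ ≤ 1 * (K * (exp (L * |r| * t) * d)) := by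
            gcongr
            · exact ht.2
            · exact h2.trans (by gcongr)
        _ = _ := by ring
    have h5 : |r| * ∫ t in (0 : ℝ)..1, K * d * exp (L * |r| * t)
        = K / L * d * (exp (L * |r|) - 1) := by
      rw [← intervalIntegral.integral_const_mul]
      have hderiv : ∀ t ∈ uIcc (0 : ℝ) 1, HasDerivAt (fun t => K / L * d * exp (L * |r| * t))
          (|r| * (K * d * exp (L * |r| * t))) t := by
        intro t _
        have := ((hasDerivAt_id t).const_mul (L * |r|)).exp.const_mul (K / L * d)
        refine this.congr_deriv ?_
        simp only [id]
        field_simp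
      rw [intervalIntegral.integral_eq_sub_of_hasDerivAt hderiv
        (Continuous.intervalIntegrable (by fun_prop) _ _)]
      simp
      ring
    calc exp (-(L * |r|)) * |r| * |I w₁ r - I w₂ r|
        ≤ exp (-(L * |r|)) * |r| * ∫ t in (0 : ℝ)..1, K * d * exp (L * |r| * t) := by gcongr
      _ = exp (-(L * |r|)) * (K / L * d * (exp (L * |r|) - 1)) := by rw [mul_assoc, h5]
      _ = K / L * d * (1 - exp (-(L * |r|))) := by
          rw [Real.exp_neg]
          field_simp
      _ ≤ K / L * d * 1 := by
          gcongr
          linarith [exp_pos (-(L * |r|))]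
      _ = K / L * d := mul_one _
  obtain ⟨w, hw⟩ : ∃ w, T w = w := ⟨_, hcontr.fixedPoint_isFixedPt⟩
  have hwc := w.continuous
  let v : ℝ → ℝ := fun r => exp (L * |r|) * w r
  have hvc : Continuous v := by fun_prop
  have hvQ : ∀ r, v r = |r| * I w r := by
    intro r
    have : w r = exp (-(L * |r|)) * |r| * I w r := by rw [← hTr, hw]
    calc v r = exp (L * |r|) * (exp (-(L * |r|)) * |r| * I w r) := by rw [← this]
      _ = _ := by rw [Real.exp_neg]; field_simp
  refine ⟨v, I w, hvc, hIc w, hvQ, fun r => rfl, fun r hr => ?_⟩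
  set P : ℝ → ℝ := fun r => ∫ s in (0 : ℝ)..r, s * H (v s) with hP
  have hPd : HasDerivAt P (r * H (v r)) r := by
    have hc : Continuous fun s => s * H (v s) := by fun_prop
    exact intervalIntegral.integral_hasDerivAt_right (hc.intervalIntegrable _ _)
      (hc.stronglyMeasurableAtFilter _ _) hc.continuousAt
  have hPv : ∀ r, 0 < r → v r = P r / r := by
    intro r hr
    have h1 : r * ∫ t in (0 : ℝ)..1, (t * r) * H (v (t * r)) = P r := by
      have := intervalIntegral.mul_integral_comp_mul_right (a := 0) (b := 1)
        (f := fun s => s * H (v s)) (c := r)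
      simpa using this
    have h2 : ∫ t in (0 : ℝ)..1, (t * r) * H (v (t * r)) = r * I w r := by
      rw [← intervalIntegral.integral_const_mul]
      refine intervalIntegral.integral_congr fun t _ => ?_
      simp only [v]
      ring
    rw [eq_div_iff hr.ne', ← h1, h2, hvQ, abs_of_pos hr]
    ring
  have hev : v =ᶠ[𝓝 r] fun r => P r / r := by
    filter_upwards [isOpen_Ioi.mem_nhds hr] with y hy using hPv y hy
  have := (hPd.div (hasDerivAt_id r) hr.ne').congr_of_eventuallyEq hev
  refine this.congr_deriv ?_
  have e1 : P r = r * v r := by rw [hPv r hr]; field_simp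
  have e2 : v r = r * I w r := by rw [hvQ, abs_of_pos hr]
  rw [e1]
  simp only [id]
  have : r ≠ 0 := hr.ne'
  rw [show r * H (v r) * r - r * v r * 1 = r ^ 2 * (H (v r) - I w r) by
    linear_combination (-r) * e2]
  field_simp

/-! ### Cone solutions -/

/-- The derivative is known only for `r > 0`, as suits singular equations. The strict inequality at
`0` persists on a short interval, and the usual barrier argument starts inside it. -/
theorem le_of_deriv_neg_at_barrier {f f' : ℝ → ℝ} {b : ℝ} (hf : Continuous f) (h0 : f 0 < b)
    (hd : ∀ r, 0 < r → HasDerivAt f (f' r) r) (hb : ∀ r, 0 < r → f r = b → f' r < 0)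
    {r : ℝ} (hr : 0 ≤ r) : f r ≤ b := by
  obtain ⟨δ, hδ, hball⟩ := Metric.eventually_nhds_iff.1 (hf.continuousAt.eventually_lt_const h0)
  by_cases hrδ : r < δ
  · exact (hball (by rw [Real.dist_eq, sub_zero, abs_of_nonneg hr]; exact hrδ)).le
  · rw [not_lt] at hrδ
    have hδ2 : 0 < δ / 2 := by positivity
    refine image_le_of_deriv_right_lt_deriv_boundary' (f := f) (f' := f') (a := δ / 2) (b := r)
      (B := fun _ => b) (B' := fun _ => 0) hf.continuousOn ?_ ?_ continuousOn_const ?_ ?_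
      (right_mem_Icc.2 (by linarith))
    · exact fun x hx => (hd x (hδ2.trans_le hx.1)).hasDerivWithinAt
    · exact (hball (by rw [Real.dist_eq, sub_zero, abs_of_pos hδ2]; linarith)).le
    · exact fun x _ => hasDerivWithinAt_const _ _ _
    · exact fun x hx h => hb x (hδ2.trans_le hx.1) h

/-- The sine profile `v` of the cone solution, with `v = r Q`. -/
theorem exists_cone_profile {c₀ c γ σ : ℝ} (hc : 0 < c) (hγ : 0 < γ) (hσ : 0 < σ)
    (hγσ : γ ^ 2 + σ ^ 2 = 1) (hc₀ : c₀ = c * σ) :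
    ∃ v Q : ℝ → ℝ, Continuous v ∧ Continuous Q ∧ (∀ r, v r = |r| * Q r) ∧
      Q 0 = (c - c₀) / 2 ∧ (∀ r, 0 ≤ v r ∧ v r ≤ γ) ∧
      ∀ r, 0 < r → HasDerivAt v (c * √(1 - v r ^ 2) - c₀ - Q r) r := by
  have hsq : ∀ x ∈ Icc 0 γ, σ ^ 2 ≤ 1 - x ^ 2 := fun x hx => by
    have := pow_le_pow_left₀ hx.1 hx.2 2
    linarith
  set G : ℝ → ℝ := fun x => c * √(1 - x ^ 2) - c₀ with hG
  have hGC : ContDiffOn ℝ 1 G (Icc 0 γ) := by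
    have : ContDiffOn ℝ 1 (fun x : ℝ => √(1 - x ^ 2)) (Icc 0 γ) :=
      ContDiffOn.sqrt (by fun_prop) fun x hx => by
        have := hsq x hx
        have h2 : 0 < σ ^ 2 := by positivity
        linarith
    exact (contDiffOn_const.mul this).sub contDiffOn_const
  obtain ⟨K, hK⟩ := hGC.exists_lipschitzOnWith one_ne_zero (convex_Icc _ _) isCompact_Icc
  -- Truncation to `[0, γ]` makes the force bounded and globally Lipschitz, away from the
  -- singularity of the root at `v = 1`. The solution is then shown never to leave `[0, γ]`.
  set H : ℝ → ℝ := fun v => G (projIcc 0 γ hγ.le v) with hH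
  have hHL : LipschitzWith K H := LipschitzWith.of_dist_le_mul fun x y => by
    refine (hK.dist_le_mul _ (projIcc 0 γ hγ.le x).2 _ (projIcc 0 γ hγ.le y).2).trans ?_
    gcongr
    simpa [Subtype.dist_eq] using (LipschitzWith.projIcc (a := 0) (b := γ) (h := hγ.le)).dist_le_mul x y
  have hG0 : ∀ x ∈ Icc 0 γ, 0 ≤ G x ∧ G x ≤ c - c₀ := by
    intro x hx
    have h1 : σ ≤ √(1 - x ^ 2) := Real.le_sqrt_of_sq_le (hsq x hx)
    have h2 : √(1 - x ^ 2) ≤ 1 := Real.sqrt_le_one.2 (by nlinarith)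
    simp only [hG, hc₀]
    constructor <;> nlinarith
  have hH0 : ∀ v, 0 ≤ H v ∧ H v ≤ c - c₀ := fun v => hG0 _ (projIcc 0 γ hγ.le v).2
  obtain ⟨v, Q, hv, hQ, hvQ, hQi, hvd⟩ := exists_singular_ode hHL (B := c - c₀) fun v => by
    rw [abs_of_nonneg (hH0 v).1]; exact (hH0 v).2
  have hv0 : v 0 = 0 := by simp [hvQ]
  have hQ0 : ∀ r, 0 ≤ Q r := fun r => by
    rw [hQi]
    exact intervalIntegral.integral_nonneg zero_le_one fun t ht => mul_nonneg ht.1 (hH0 _).1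
  have hvpos : ∀ r, 0 ≤ v r := fun r => by
    rw [hvQ]; exact mul_nonneg (abs_nonneg _) (hQ0 r)
  have hHG : ∀ x ∈ Icc 0 γ, H x = G x := fun x hx => by
    simp only [hH]; rw [projIcc_of_mem _ hx]
  have hvle : ∀ r, 0 ≤ r → v r ≤ γ := by
    intro r hr
    refine le_of_deriv_neg_at_barrier hv (by rw [hv0]; exact hγ) hvd (fun r hr h => ?_) hr
    -- At `v = γ` the force is `c σ - c₀ = 0`, so `v' = -v / r < 0` and the barrier cannot be
    -- crossed.
    have h1 : H (v r) = 0 := by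
      rw [h, hHG γ (right_mem_Icc.2 hγ.le)]
      simp only [hG]
      rw [show 1 - γ ^ 2 = σ ^ 2 by linarith, Real.sqrt_sq hσ.le, hc₀, sub_self]
    have h2 := hvQ r
    rw [abs_of_pos hr, h] at h2
    have h3 : 0 < Q r := by
      by_contra hcon
      have : r * Q r ≤ 0 := mul_nonpos_of_nonneg_of_nonpos hr.le (not_lt.1 hcon)
      linarith
    linarith
  -- The upper bound on `v` is known for `r ≥ 0` only; the even extension carries it to all `r`.
  refine ⟨fun r => v |r|, fun r => Q |r|, by fun_prop, by fun_prop, fun r => by simp [hvQ |r|],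
    ?_, fun r => ⟨hvpos _, hvle _ (abs_nonneg r)⟩, fun r hr => ?_⟩
  · simp only [abs_zero]
    rw [hQi]
    have h1 : H 0 = c - c₀ := by
      rw [hHG 0 (left_mem_Icc.2 hγ.le)]; simp [hG]
    simp only [mul_zero, hv0, h1]
    rw [intervalIntegral.integral_mul_const]
    simp
    ring
  · have h1 : (fun r => v |r|) =ᶠ[𝓝 r] v := by
      filter_upwards [isOpen_Ioi.mem_nhds hr] with y hy
      rw [abs_of_pos hy]
    have := (hvd r hr).congr_of_eventuallyEq h1
    rw [hHG _ ⟨hvpos r, hvle r hr.le⟩] at this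
    simp only [abs_of_pos hr]
    exact this

/-- Existence of the radial solution, with its radial profile `u` and sine profile `v`. -/
theorem exists_radial_solution {c₀ c γ σ : ℝ} (hc : 0 < c) (hγ : 0 < γ) (hσ : 0 < σ)
    (hγσ : γ ^ 2 + σ ^ 2 = 1) (hc₀ : c₀ = c * σ) (a₀ : ℝ) :
    ∃ (φ : Plane → ℝ) (u v : ℝ → ℝ), IsClassicalSolution c₀ c φ ∧ (∀ x, φ x = u ‖x‖) ∧
      φ 0 = a₀ ∧ fderiv ℝ φ 0 = 0 ∧ (∀ x, ‖fderiv ℝ φ x‖ ≤ γ / σ) ∧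
      Continuous v ∧ v 0 = 0 ∧ (∀ r, 0 ≤ v r ∧ v r ≤ γ) ∧
      (∀ r, 0 < r → HasDerivAt u (-(v r / √(1 - v r ^ 2))) r) ∧
      ∀ r, 0 < r → HasDerivAt v (c * √(1 - v r ^ 2) - c₀ - v r / r) r := by
  obtain ⟨v, Q, hv, hQ, hvQ, hQ0, hvb, hvd⟩ := exists_cone_profile hc hγ hσ hγσ hc₀
  have hv0 : v 0 = 0 := by simp [hvQ]
  set q : ℝ → ℝ := fun r => √(1 - v r ^ 2) with hq
  have hvsq : ∀ r, σ ^ 2 ≤ 1 - v r ^ 2 := fun r => by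
    have := pow_le_pow_left₀ (hvb r).1 (hvb r).2 2
    linarith
  have hσq : ∀ r, σ ≤ q r := fun r => Real.le_sqrt_of_sq_le (hvsq r)
  have hqpos : ∀ r, 0 < q r := fun r => hσ.trans_le (hσq r)
  have hqne : ∀ r, q r ≠ 0 := fun r => (hqpos r).ne'
  have hqsq : ∀ r, q r ^ 2 = 1 - v r ^ 2 := fun r =>
    Real.sq_sqrt ((sq_nonneg σ).trans (hvsq r))
  have hqc : Continuous q := by fun_prop
  have hqd : ∀ r, 0 < r → HasDerivAt q (-(v r * (c * q r - c₀ - Q r)) / q r) r := by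
    intro r hr
    have := (((hvd r hr).pow 2).const_sub 1).sqrt (by
      have := hvsq r
      have h2 : 0 < σ ^ 2 := by positivity
      simp only [Pi.pow_apply]
      linarith)
    refine this.congr_deriv ?_
    simp only [Pi.pow_apply]
    change _ / (2 * q r) = _
    have := hqne r
    field_simp
    push_cast
    ring
  -- Here `m = u' / r` and `n = u'' - u' / r`, computed from `u' = -v / q`, `u'' = -v' / q³` and `v
  -- = r Q`.
  set m : ℝ → ℝ := fun r => -(Q r / q r) with hm
  set n : ℝ → ℝ := fun r => -((c * q r - c₀ - Q r) / q r ^ 3) + Q r / q r with hn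
  have hmc : Continuous m := (hQ.div hqc hqne).neg
  have hnc : Continuous n := by
    refine Continuous.add (Continuous.neg (Continuous.div (by fun_prop) (by fun_prop) ?_))
      (hQ.div hqc hqne)
    exact fun r => pow_ne_zero 3 (hqne r)
  -- The value `Q 0 = (c - c₀) / 2` is exactly what makes the radial and angular curvatures agree at
  -- the origin.
  have hn0 : n 0 = 0 := by
    simp only [hn, hq, hv0, hQ0]
    norm_num
    ring
  have hmn : ∀ r, 0 < r → HasDerivAt m (n r / r) r := by
    intro r hr
    have h1 : HasDerivAt (fun r => -(v r / q r / r)) (n r / r) r := by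
      refine ((((hvd r hr).div (hqd r hr) (hqne r)).div (hasDerivAt_id r) hr.ne').neg).congr_deriv ?_
      have e1 : v r = r * Q r := by rw [hvQ, abs_of_pos hr]
      have e2 := hqsq r
      have := hqne r
      simp only [hn, id, Pi.div_apply]
      change -((((c * q r - c₀ - Q r) * q r - v r * (-(v r * (c * q r - c₀ - Q r)) / q r)) / q r ^ 2 * r
        - v r / q r * 1) / r ^ 2) = _
      have e3 : (c * q r - c₀ - Q r) * q r - v r * (-(v r * (c * q r - c₀ - Q r)) / q r)
          = (c * q r - c₀ - Q r) / q r := by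
        field_simp
        linear_combination (c * q r - c₀ - Q r) * e2
      rw [e3, e1]
      field_simp
      ring
    refine h1.congr_of_eventuallyEq ?_
    filter_upwards [isOpen_Ioi.mem_nhds hr] with y hy
    have hy' : y ≠ 0 := (mem_Ioi.1 hy).ne'
    simp only [hm]
    rw [hvQ y, abs_of_pos hy]
    field_simp
  -- Taking the profile as a function of `ρ = |x|²` makes the chain rule valid at the origin too.
  set U : ℝ → ℝ := fun ρ => a₀ + ∫ τ in (0 : ℝ)..ρ, m (√τ) / 2 with hU
  have hUd : ∀ ρ, HasDerivAt U (m (√ρ) / 2) ρ := by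
    intro ρ
    have hcont : Continuous fun τ => m (√τ) / 2 := by fun_prop
    exact (intervalIntegral.integral_hasDerivAt_right (hcont.intervalIntegrable _ _)
      (hcont.stronglyMeasurableAtFilter _ _) hcont.continuousAt).const_add a₀
  have hφd : ∀ y : Plane, HasFDerivAt (fun x : Plane => U (‖x‖ ^ 2)) (m ‖y‖ • dotL y) y := by
    intro y
    have := (hUd (‖y‖ ^ 2)).comp_hasFDerivAt y (hasStrictFDerivAt_norm_sq y).hasFDerivAt
    refine this.congr_fderiv ?_
    rw [Real.sqrt_sq (norm_nonneg _)]
    ext z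
    simp
    ring
  obtain ⟨hC, hH⟩ := contDiff_two_of_radial hmc hnc hn0 hmn hφd
  refine ⟨fun x => U (‖x‖ ^ 2), fun r => U (r ^ 2), v, ⟨hC, fun x => ?_⟩, fun x => rfl,
    by simp [hU], ?_, fun x => ?_, hv, hv0, hvb, fun r hr => ?_, fun r hr => ?_⟩
  · have hg : gradient (fun x : Plane => U (‖x‖ ^ 2)) x = m ‖x‖ • x := by
      refine gradient_eq_of_hasFDerivAt ?_
      rw [map_smul]
      exact hφd x
    rw [hg, hamiltonian_radial c₀ c _ _ (hess_of_hasFDerivAt_radial (hH x))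
      (fun h => by rw [h, norm_zero, hn0])]
    set r := ‖x‖
    have hr : |r| = r := abs_of_nonneg (norm_nonneg x)
    have e1 : m r ^ 2 * r ^ 2 = v r ^ 2 / q r ^ 2 := by
      simp only [hm]; rw [hvQ, hr]; field_simp
    have e2 := hqsq r
    have e3 : √(1 + v r ^ 2 / q r ^ 2) = 1 / q r := by
      have : 1 + v r ^ 2 / q r ^ 2 = (1 / q r) ^ 2 := by
        have := hqne r
        field_simp
        linarith
      rw [this, Real.sqrt_sq (by have := hqpos r; positivity)]
    rw [e1, e3]
    have e4 : m r + n r = -((c * q r - c₀ - Q r) / q r ^ 3) := by simp only [hm, hn]; ring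
    have e5 : 2 * m r + n r = -((c * q r - c₀ - Q r) / q r ^ 3) - Q r / q r := by
      simp only [hm, hn]; ring
    rw [e4, e5]
    have := hqne r
    generalize q r = k at *
    field_simp
    linear_combination (c₀ + Q r - c * k) * e2
  · have := (hφd 0).fderiv
    rw [this]; simp
  · rw [(hφd x).fderiv, norm_smul, norm_dotL_apply]
    have e1 : ‖m ‖x‖‖ * ‖x‖ = v ‖x‖ / q ‖x‖ := by
      have h1 : 0 ≤ v ‖x‖ / q ‖x‖ := div_nonneg (hvb _).1 (hqpos _).le
      have h2 : v ‖x‖ / q ‖x‖ = -(m ‖x‖ * ‖x‖) := by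
        simp only [hm]; rw [hvQ, abs_of_nonneg (norm_nonneg x)]; ring
      rw [← abs_of_nonneg h1, h2, abs_neg, abs_mul, Real.norm_eq_abs, abs_of_nonneg (norm_nonneg x)]
    rw [e1]
    have := hσq ‖x‖
    have := (hvb ‖x‖).2
    gcongr
  · have := (hUd (r ^ 2)).comp r ((hasDerivAt_id r).pow 2)
    refine this.congr_deriv ?_
    rw [Real.sqrt_sq hr.le]
    simp only [hm, id]
    change _ = -(v r / q r)
    rw [hvQ, abs_of_pos hr]
    push_cast
    ring
  · have e1 : v r / r = Q r := by rw [hvQ, abs_of_pos hr]; field_simp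
    rw [e1]
    exact hvd r hr

/-! ### Logarithmic expansion of cone solutions -/

theorem abs_sub_le_of_deriv_le_inv_sq {Z Z' : ℝ → ℝ} {C : ℝ} (hC : 0 ≤ C)
    (hd : ∀ r, 1 ≤ r → HasDerivAt Z (Z' r) r) (hb : ∀ r, 1 ≤ r → |Z' r| ≤ C / r ^ 2)
    {r : ℝ} (hr : 1 ≤ r) : |Z r - Z 1| ≤ C := by
  have key : ∀ (Y Y' : ℝ → ℝ), (∀ r, 1 ≤ r → HasDerivAt Y (Y' r) r) →
      (∀ r, 1 ≤ r → -(C / r ^ 2) ≤ Y' r) → Y 1 - Y r ≤ C := by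
    intro Y Y' hY hY'
    have hder : ∀ x, 1 ≤ x → HasDerivAt (fun x => Y x - C * x⁻¹) (Y' x + C / x ^ 2) x := by
      intro x hx
      have hx0 : x ≠ 0 := by positivity
      refine ((hY x hx).sub ((hasDerivAt_inv hx0).const_mul C)).congr_deriv ?_
      ring
    have hmono : MonotoneOn (fun x => Y x - C * x⁻¹) (Ici 1) := by
      refine monotoneOn_of_deriv_nonneg (convex_Ici 1)
        (fun x hx => (hder x hx).continuousAt.continuousWithinAt)
        (fun x hx => (hder x (interior_subset hx)).differentiableAt.differentiableWithinAt)
        (fun x hx => ?_)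
      rw [(hder x (interior_subset hx)).deriv]
      linarith [hY' x (interior_subset hx)]
    have h1 := hmono (mem_Ici.2 le_rfl) (mem_Ici.2 hr) hr
    have h2 : 0 ≤ C * r⁻¹ := by positivity
    simp only [inv_one] at h1
    linarith
  rw [abs_sub_comm, abs_le]
  constructor
  · have := key (fun r => -Z r) (fun r => -Z' r) (fun r hr => (hd r hr).neg)
      (fun r hr => by linarith [(abs_le.1 (hb r hr)).2])
    linarith
  · exact key Z Z' hd fun r hr => (abs_le.1 (hb r hr)).1

/-- Second order comparison of the slope `v / q` with the force `q - σ`. -/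
theorem slope_sub_force_le {γ σ v q : ℝ} (hγ : 0 < γ) (hσ : 0 < σ) (hγσ : γ ^ 2 + σ ^ 2 = 1)
    (hv0 : 0 ≤ v) (hvγ : v ≤ γ) (hσq : σ ≤ q) (hq : q ^ 2 = 1 - v ^ 2) :
    |γ / σ - v / q - (q - σ) / (γ * σ ^ 2)| ≤ 4 / (γ ^ 2 * σ ^ 5) * (γ - v) ^ 2 := by
  have hq0 : 0 < q := hσ.trans_le hσq
  have hγ1 : γ ≤ 1 := by nlinarith
  have hσ1 : σ ≤ 1 := by nlinarith
  have hq1 : q ≤ 1 := by nlinarith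
  have hD0 : 0 < γ * q + v * σ := by positivity
  have e1 : γ / σ - v / q = (γ - v) * (γ + v) / (σ * q * (γ * q + v * σ)) := by
    rw [eq_div_iff (by positivity)]
    field_simp
    linear_combination γ ^ 2 * hq - v ^ 2 * hγσ
  have e2 : q - σ = (γ - v) * (γ + v) / (q + σ) := by
    rw [eq_div_iff (by positivity)]
    linear_combination hq - hγσ
  -- The coefficient `1 / (γ σ²)` cancels the first-order terms at `v = γ`, leaving an explicit
  -- factor `(γ - v)²`.
  have e3 : γ / σ - v / q - (q - σ) / (γ * σ ^ 2) =
      (γ - v) ^ 2 * ((γ + v) * (σ * q - γ * (γ + v)))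
        / (q * (γ * q + v * σ) * (γ * σ ^ 2) * (q + σ)) := by
    rw [e1, e2]
    field_simp
    linear_combination (γ - v) * γ * (hγσ - hq)
  have hden : γ ^ 2 * σ ^ 5 ≤ q * (γ * q + v * σ) * (γ * σ ^ 2) * (q + σ) := by
    calc γ ^ 2 * σ ^ 5 = σ * (γ * σ) * (γ * σ ^ 2) * σ := by ring
      _ ≤ q * (γ * q + v * σ) * (γ * σ ^ 2) * (q + σ) := by
        gcongr
        · nlinarith [mul_nonneg hv0 hσ.le, mul_le_mul_of_nonneg_left hσq hγ.le]
        · linarith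
  have hnum : |(γ + v) * (σ * q - γ * (γ + v))| ≤ 4 := by
    rw [abs_mul]
    have h1 : |γ + v| ≤ 2 := by rw [abs_of_nonneg (by positivity)]; linarith
    have h2 : |σ * q - γ * (γ + v)| ≤ 2 := by
      have h3 : σ * q ≤ 1 := mul_le_one₀ hσ1 hq0.le hq1
      have h4 : 0 ≤ σ * q := by positivity
      have h5 : γ * (γ + v) ≤ 2 := by nlinarith
      have h6 : 0 ≤ γ * (γ + v) := by positivity
      rw [abs_le]
      constructor <;> linarith
    calc |γ + v| * |σ * q - γ * (γ + v)| ≤ 2 * 2 := by gcongr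
      _ = 4 := by norm_num
  have hden0 : 0 < q * (γ * q + v * σ) * (γ * σ ^ 2) * (q + σ) := by positivity
  rw [e3, abs_div, abs_of_pos hden0, abs_mul, abs_of_nonneg (sq_nonneg (γ - v)),
    div_mul_eq_mul_div, mul_comm ((γ - v) ^ 2)]
  gcongr

/-- The slope defect `γ / σ - v / q` equals `(q - σ) / (γ σ²)` up to `O((γ - v)²)`, and the equation
gives `c (q - σ) = v' + v / r`. Since `γ - v = O(1 / r)`, integration yields the logarithm, a
bounded multiple of `v`, and an integrable `O(1 / r²)`. -/
theorem radial_profile_log_expansion {c₀ c γ σ : ℝ} (hc : 0 < c) (hγ : 0 < γ) (hσ : 0 < σ)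
    (hγσ : γ ^ 2 + σ ^ 2 = 1) (hc₀ : c₀ = c * σ) {u v : ℝ → ℝ} (hv : Continuous v)
    (hvb : ∀ r, 0 ≤ v r ∧ v r ≤ γ)
    (hu : ∀ r, 0 < r → HasDerivAt u (-(v r / √(1 - v r ^ 2))) r)
    (hvd : ∀ r, 0 < r → HasDerivAt v (c * √(1 - v r ^ 2) - c₀ - v r / r) r) :
    ∃ C, ∀ r, 1 ≤ r → |u r + γ / σ * r - 1 / (c₀ * σ) * log r| ≤ C := by
  set q : ℝ → ℝ := fun r => √(1 - v r ^ 2) with hq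
  have hvsq : ∀ r, σ ^ 2 ≤ 1 - v r ^ 2 := fun r => by
    have := pow_le_pow_left₀ (hvb r).1 (hvb r).2 2
    linarith
  have hσq : ∀ r, σ ≤ q r := fun r => Real.le_sqrt_of_sq_le (hvsq r)
  have hqsq : ∀ r, q r ^ 2 = 1 - v r ^ 2 := fun r =>
    Real.sq_sqrt ((sq_nonneg σ).trans (hvsq r))
  have hγ1 : γ ≤ 1 := by nlinarith
  have hσ1 : σ ≤ 1 := by nlinarith
  -- For `y = r (γ - v)` one has `y' = γ - r c (q - σ) ≤ γ - (γ c / 2) y`, which is negative at `y =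
  -- 3 / c`.
  have hy : ∀ r, 0 ≤ r → r * (γ - v r) ≤ 3 / c := by
    intro r hr
    refine le_of_deriv_neg_at_barrier (f := fun r => r * (γ - v r))
      (f' := fun r => γ - r * (c * (q r - σ))) (b := 3 / c) (by fun_prop)
      (by simp only [zero_mul]; positivity) (fun r hr => ?_) (fun r hr h => ?_) hr
    · refine ((hasDerivAt_id r).mul ((hvd r hr).const_sub γ)).congr_deriv ?_
      simp only [id, hc₀]
      change 1 * (γ - v r) + r * -(c * q r - c * σ - v r / r) = _
      field_simp
      ring
    · have h1 : γ / 2 * (γ - v r) ≤ q r - σ := by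
        have h2 : (q r - σ) * (q r + σ) = (γ - v r) * (γ + v r) := by
          linear_combination hqsq r - hγσ
        have hq1 : q r ≤ 1 := by
          have := hqsq r
          nlinarith [sq_nonneg (v r), hσq r]
        have h3 : 0 ≤ (γ - v r) * v r := mul_nonneg (by linarith [(hvb r).2]) (hvb r).1
        have h4 : 0 ≤ q r - σ := by linarith [hσq r]
        nlinarith
      have h5 : r * (c * (γ / 2 * (γ - v r))) ≤ r * (c * (q r - σ)) := by gcongr
      have h6 : r * (c * (γ / 2 * (γ - v r))) = γ / 2 * c * (3 / c) := by rw [← h]; ring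
      have h7 : γ / 2 * c * (3 / c) = 3 * γ / 2 := by field_simp
      linarith
  set a : ℝ := 1 / (c₀ * σ) with ha
  -- Since `a = b γ`, the terms `-a / r` and `b v / r` in the derivative of `Z` combine to `-b (γ -
  -- v) / r`.
  set b : ℝ := 1 / (c * γ * σ ^ 2) with hb
  have hb0 : 0 < b := by positivity
  set Z : ℝ → ℝ := fun r => u r + γ / σ * r - a * log r - b * v r with hZ
  have hZd : ∀ r, 1 ≤ r → HasDerivAt Z
      ((γ / σ - v r / q r - (q r - σ) / (γ * σ ^ 2)) - b * (γ - v r) / r) r := by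
    intro r hr
    have hr0 : 0 < r := by linarith
    refine ((((hu r hr0).add ((hasDerivAt_id r).const_mul (γ / σ))).sub
      ((Real.hasDerivAt_log hr0.ne').const_mul a)).sub ((hvd r hr0).const_mul b)).congr_deriv ?_
    change -(v r / q r) + γ / σ * 1 - a * r⁻¹ - b * (c * q r - c₀ - v r / r) = _
    have hq0 : q r ≠ 0 := (hσ.trans_le (hσq r)).ne'
    simp only [ha, hb, hc₀]
    field_simp
    ring
  set C : ℝ := 4 / (γ ^ 2 * σ ^ 5) * (3 / c) ^ 2 + b * (3 / c) with hC
  have hC0 : 0 ≤ C := by positivity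
  have hZb : ∀ r, 1 ≤ r →
      |(γ / σ - v r / q r - (q r - σ) / (γ * σ ^ 2)) - b * (γ - v r) / r| ≤ C / r ^ 2 := by
    intro r hr
    have hr0 : 0 < r := by linarith
    have h1 := slope_sub_force_le hγ hσ hγσ (hvb r).1 (hvb r).2 (hσq r) (hqsq r)
    have h0 : 0 ≤ γ - v r := by linarith [(hvb r).2]
    have h2 : γ - v r ≤ 3 / c / r := by
      rw [le_div_iff₀ hr0, mul_comm]; exact hy r hr0.le
    refine (abs_sub _ _).trans ?_
    have h3 : |b * (γ - v r) / r| ≤ b * (3 / c / r) / r := by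
      rw [abs_of_nonneg (by positivity)]; gcongr
    have h4 : 4 / (γ ^ 2 * σ ^ 5) * (γ - v r) ^ 2 ≤ 4 / (γ ^ 2 * σ ^ 5) * (3 / c / r) ^ 2 := by
      gcongr
    calc _ ≤ 4 / (γ ^ 2 * σ ^ 5) * (3 / c / r) ^ 2 + b * (3 / c / r) / r :=
          add_le_add (h1.trans h4) h3
      _ = C / r ^ 2 := by rw [hC]; field_simp
  refine ⟨|Z 1| + C + b * γ, fun r hr => ?_⟩
  have h1 := abs_sub_le_of_deriv_le_inv_sq hC0 hZd hZb hr
  have h2 : u r + γ / σ * r - a * log r = (Z r - Z 1) + Z 1 + b * v r := by simp only [hZ]; ring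
  rw [h2]
  have h3 : |b * v r| ≤ b * γ := by
    rw [abs_of_nonneg (mul_nonneg hb0.le (hvb r).1)]
    gcongr
    exact (hvb r).2
  calc _ ≤ |Z r - Z 1| + |Z 1| + |b * v r| := abs_add_three _ _ _
    _ ≤ _ := by linarith

theorem isLittleO_of_log_expansion {φ : Plane → ℝ} {k a C : ℝ}
    (h : ∀ x, 1 ≤ ‖x‖ → |φ x + k * ‖x‖ - a * log ‖x‖| ≤ C) :
    (fun x => φ x - (-k * ‖x‖)) =o[Bornology.cobounded Plane] fun x => ‖x‖ := by
  have hn : Tendsto (fun x : Plane => ‖x‖) (Bornology.cobounded Plane) atTop :=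
    tendsto_norm_cobounded_atTop
  have h1 : (fun x : Plane => a * log ‖x‖) =o[Bornology.cobounded Plane] fun x => ‖x‖ :=
    (Real.isLittleO_log_id_atTop.comp_tendsto hn).const_mul_left a
  have h2 : (fun x : Plane => φ x + k * ‖x‖ - a * log ‖x‖) =O[Bornology.cobounded Plane]
      fun _ => (1 : ℝ) := by
    refine IsBigO.of_bound C ?_
    filter_upwards [hn.eventually_ge_atTop 1] with x hx
    simpa using h x hx
  have h3 : (fun _ : Plane => (1 : ℝ)) =o[Bornology.cobounded Plane] fun x => ‖x‖ :=
    (isLittleO_const_id_atTop (1 : ℝ)).comp_tendsto hn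
  refine ((h2.trans_isLittleO h3).add h1).congr_left fun x => ?_
  ring

theorem hamiltonian_zero_zero (c₀ : ℝ) : hamiltonian c₀ c₀ 0 0 = 0 := by
  simp [hamiltonian]

theorem hess_const (a : ℝ) (x : Plane) : hess (fun _ => a) x = 0 := by
  have : fderiv ℝ (fun _ : Plane => a) = fun _ => 0 := by funext y; simp
  ext i j
  simp [hess, this]

/-- Existence of cone solutions, with their properties. -/
theorem exists_coneSolution {c₀ α : ℝ} (hc₀ : 0 < c₀) (hα : 0 < α) (hα' : α ≤ π / 2) (a₀ : ℝ) :
    ∃ φ : Plane → ℝ, IsConeSolution c₀ α φ ∧ φ 0 = a₀ ∧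
      (∀ x y, |φ x - φ y| ≤ cot α * ‖x - y‖) ∧
      (α < π / 2 → ∃ C, ∀ x, 1 ≤ ‖x‖ →
        |φ x + cot α * ‖x‖ - 1 / (c₀ * sin α) * log ‖x‖| ≤ C) ∧
      (α = π / 2 → ∀ x, φ x = a₀) := by
  have hσ : 0 < sin α := sin_pos_of_pos_of_lt_pi hα (by linarith [pi_pos])
  rcases hα'.eq_or_lt with hα2 | hα2
  -- For `α = π / 2` one has `c = c₀` and the cone degenerates to a constant, with no logarithmic
  -- term.
  · have hcot : cot α = 0 := by rw [hα2, cot_eq_cos_div_sin]; simp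
    refine ⟨fun _ => a₀, ⟨⟨contDiff_const, fun x => ?_⟩, fun _ _ _ => rfl, by simp, ?_⟩, rfl,
      by simp [hcot], fun h => absurd hα2 h.ne, fun _ _ => rfl⟩
    · have hg : gradient (fun _ : Plane => a₀) x = 0 := by simp [gradient]
      rw [hg, hess_const, hα2, sin_pi_div_two, div_one, hamiltonian_zero_zero]
    · rw [hcot]
      simp only [neg_zero, zero_mul, sub_zero]
      exact (isLittleO_const_id_atTop a₀).comp_tendsto tendsto_norm_cobounded_atTop
  · have hγ : 0 < cos α := cos_pos_of_mem_Ioo ⟨by linarith, hα2⟩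
    have hγσ : cos α ^ 2 + sin α ^ 2 = 1 := cos_sq_add_sin_sq α
    have hc : 0 < c₀ / sin α := by positivity
    have hcc : c₀ = c₀ / sin α * sin α := by field_simp
    obtain ⟨φ, u, v, hsol, hφu, h0, hd0, hdb, hv, -, hvb, hud, hvd⟩ :=
      exists_radial_solution hc hγ hσ hγσ hcc a₀
    obtain ⟨C, hC⟩ := radial_profile_log_expansion hc hγ hσ hγσ hcc hv hvb hud hvd
    rw [← cot_eq_cos_div_sin] at hC
    have hC' : ∀ x, 1 ≤ ‖x‖ → |φ x + cot α * ‖x‖ - 1 / (c₀ * sin α) * log ‖x‖| ≤ C :=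
      fun x hx => by rw [hφu]; exact hC _ hx
    refine ⟨φ, ⟨hsol, fun x y h => by rw [hφu, hφu, h], hd0, isLittleO_of_log_expansion hC'⟩, h0,
      fun x y => ?_, fun _ => ⟨C, hC'⟩, fun h => absurd h hα2.ne⟩
    rw [← Real.norm_eq_abs, cot_eq_cos_div_sin]
    exact convex_univ.norm_image_sub_le_of_norm_fderiv_le (𝕜 := ℝ)
      (fun z _ => hsol.1.differentiable (by norm_num) z) (fun z _ => hdb z) (mem_univ _)
      (mem_univ _)

theorem IsConeSolution.eq {c₀ α : ℝ} {φ₁ φ₂ : Plane → ℝ} (h₁ : IsConeSolution c₀ α φ₁)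
    (h₂ : IsConeSolution c₀ α φ₂) (h0 : φ₁ 0 = φ₂ 0) : φ₁ = φ₂ :=
  radial_solution_unique h₁.solution h₁.radial h₁.deriv_zero h₂.solution h₂.radial
    h₂.deriv_zero h0

/-! ### Viscosity super-solutions -/

/-- A negative second derivative would make `t` a local maximum as well, hence `k` locally constant,
a contradiction. -/
theorem deriv_deriv_nonneg_of_isLocalMin {k : ℝ → ℝ} {t : ℝ} (hk : ContinuousAt k t)
    (h : IsLocalMin k t) : 0 ≤ deriv (deriv k) t := by
  by_contra hneg
  rw [not_le] at hneg
  have hmax : IsLocalMax k t := isLocalMax_of_deriv_deriv_neg hneg h.deriv_eq_zero hk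
  have hconst : k =ᶠ[𝓝 t] fun _ => k t := by
    filter_upwards [h, hmax] with y h1 h2 using le_antisymm h2 h1
  have h2 := hconst.deriv.deriv_eq
  simp at h2
  exact absurd h2 hneg.ne

theorem fderiv_fderiv_apply_eq_sum_hess (g : Plane → ℝ) (x v : Plane) :
    fderiv ℝ (fderiv ℝ g) x v v = ∑ i, ∑ j, hess g x i j * v i * v j := by
  have hv : v = v 0 • EuclideanSpace.single 0 1 + v 1 • EuclideanSpace.single 1 1 := by
    ext i
    fin_cases i <;> simp
  conv_lhs => rw [hv]
  simp [hess, Fin.sum_univ_two]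
  ring

theorem fderiv_fderiv_nonneg_of_isLocalMin {g : Plane → ℝ} {x : Plane} (hg : ContDiff ℝ 2 g)
    (h : IsLocalMin g x) (v : Plane) : 0 ≤ fderiv ℝ (fderiv ℝ g) x v v := by
  have hline : ∀ t : ℝ, HasDerivAt (fun t : ℝ => x + t • v) v t := fun t => by
    simpa using ((hasDerivAt_id t).smul_const v).const_add x
  have hg1 : Differentiable ℝ (fderiv ℝ g) :=
    (hg.fderiv_right (m := 1) (by norm_num)).differentiable (by norm_num)
  have hd1 : deriv (fun t : ℝ => g (x + t • v)) = fun t => fderiv ℝ g (x + t • v) v := by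
    funext t
    exact ((hg.differentiable (by norm_num) _).hasFDerivAt.comp_hasDerivAt t (hline t)).deriv
  have hd2 : deriv (deriv fun t : ℝ => g (x + t • v)) 0 = fderiv ℝ (fderiv ℝ g) x v v := by
    rw [hd1]
    have h0 : HasFDerivAt (fderiv ℝ g) (fderiv ℝ (fderiv ℝ g) x) (x + (0 : ℝ) • v) := by
      rw [zero_smul, add_zero]
      exact (hg1 x).hasFDerivAt
    have h1 := h0.comp_hasDerivAt (0 : ℝ) (hline 0)
    exact ((ContinuousLinearMap.apply ℝ ℝ v).hasFDerivAt.comp_hasDerivAt (0 : ℝ) h1).deriv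
  have hcont : ContinuousAt (fun t : ℝ => x + t • v) 0 := (hline 0).continuousAt
  rw [← hd2]
  refine deriv_deriv_nonneg_of_isLocalMin (hg.continuous.comp (by fun_prop)).continuousAt ?_
  have h2 : Tendsto (fun t : ℝ => x + t • v) (𝓝 0) (𝓝 x) := by simpa using hcont.tendsto
  have := h2.eventually h
  simpa [IsLocalMin, IsMinFilter] using this

/-- Ellipticity: the Hamiltonian is monotone at a minimum of the difference. -/
theorem hamiltonian_le_of_isLocalMin_sub {c₀ c : ℝ} {f ψ : Plane → ℝ} {x : Plane}
    (hf : ContDiff ℝ 2 f) (hψ : ContDiff ℝ 2 ψ) (h : IsLocalMin (fun y => f y - ψ y) x) :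
    hamiltonian c₀ c (gradient f x) (hess f x) ≤ hamiltonian c₀ c (gradient ψ x) (hess ψ x) := by
  have hfd := hf.differentiable (by norm_num)
  have hψd := hψ.differentiable (by norm_num)
  have hsub : (fderiv ℝ fun y => f y - ψ y) = fun y => fderiv ℝ f y - fderiv ℝ ψ y := by
    funext y
    exact fderiv_fun_sub (hfd y) (hψd y)
  have hgrad : gradient f x = gradient ψ x := by
    have h0 := h.fderiv_eq_zero
    rw [hsub] at h0
    unfold gradient
    rw [sub_eq_zero.1 h0]
  have hD : ∀ v : Plane, 0 ≤ (∑ i, ∑ j, hess f x i j * v i * v j) - ∑ i, ∑ j, hess ψ x i j * v i * v j := by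
    intro v
    have h1 := fderiv_fderiv_nonneg_of_isLocalMin (hf.sub hψ) h v
    have hf2 : Differentiable ℝ (fderiv ℝ f) :=
      (hf.fderiv_right (m := 1) (by norm_num)).differentiable (by norm_num)
    have hψ2 : Differentiable ℝ (fderiv ℝ ψ) :=
      (hψ.fderiv_right (m := 1) (by norm_num)).differentiable (by norm_num)
    rw [hsub, fderiv_fun_sub (hf2 x) (hψ2 x)] at h1
    rw [← fderiv_fderiv_apply_eq_sum_hess, ← fderiv_fderiv_apply_eq_sum_hess]
    simpa using h1
  rw [hgrad]
  set p := gradient ψ x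
  set A := hess f x
  set B := hess ψ x
  have hp := norm_sq_plane p
  have e0 := hD (EuclideanSpace.single 0 1)
  have e1 := hD (EuclideanSpace.single 1 1)
  -- By `key` below, the second-order part is `-(tr M + ⟨M p⊥, p⊥⟩) / W³`, so testing on the two
  -- basis vectors and on `p⊥` is enough.
  have e2 := hD !₂[-(p 1), p 0]
  simp [Fin.sum_univ_two] at e0 e1 e2
  unfold hamiltonian
  simp only [Fin.sum_univ_two, Matrix.trace_fin_two]
  set W := √(1 + ‖p‖ ^ 2) with hWdef
  have hW : W ^ 2 = 1 + ‖p‖ ^ 2 := Real.sq_sqrt (by positivity)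
  have hWp : 0 < W := Real.sqrt_pos.2 (by positivity)
  have key : ∀ M : Matrix (Fin 2) (Fin 2) ℝ,
      -(M 0 0 + M 1 1) / W + (M 0 0 * p 0 * p 0 + M 0 1 * p 0 * p 1
        + (M 1 0 * p 1 * p 0 + M 1 1 * p 1 * p 1)) / W ^ 3
      = -(M 0 0 + M 1 1 + (M 0 0 * p 1 * p 1 - M 0 1 * p 1 * p 0 - M 1 0 * p 0 * p 1
        + M 1 1 * p 0 * p 0)) / W ^ 3 := by
    intro M
    field_simp
    rw [hW, hp]
    ring
  rw [key, key]
  have : -(A 0 0 + A 1 1 + (A 0 0 * p 1 * p 1 - A 0 1 * p 1 * p 0 - A 1 0 * p 0 * p 1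
        + A 1 1 * p 0 * p 0)) / W ^ 3 ≤ -(B 0 0 + B 1 1 + (B 0 0 * p 1 * p 1 - B 0 1 * p 1 * p 0
        - B 1 0 * p 0 * p 1 + B 1 1 * p 0 * p 0)) / W ^ 3 := by
    refine div_le_div_of_nonneg_right ?_ (by positivity)
    linarith
  linarith

/-- A test function touching `φ` from below at `x` also touches the larger smooth solution `f`
there, and ellipticity compares it with `F = 0`. -/
theorem IsClassicalSolution.nonneg_of_touching {c₀ c : ℝ} {f φ ψ : Plane → ℝ} {x : Plane}
    (hf : IsClassicalSolution c₀ c f) (hψ : ContDiff ℝ 2 ψ)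
    (h : IsLocalMin (fun y => φ y - ψ y) x) (hle : ∀ᶠ y in 𝓝 x, φ y ≤ f y) (hx : φ x = f x) :
    0 ≤ hamiltonian c₀ c (gradient ψ x) (hess ψ x) := by
  rw [← hf.2 x]
  refine hamiltonian_le_of_isLocalMin_sub hf.1 hψ ?_
  filter_upwards [h, hle] with y h1 h2
  change φ x - ψ x ≤ φ y - ψ y at h1
  change f x - ψ x ≤ f y - ψ y
  linarith

theorem isClassicalSolution_planeFun {c₀ α : ℝ} (hα : 0 < sin α) (lam θ : ℝ) :
    IsClassicalSolution c₀ (c₀ / sin α) (planeFun c₀ α lam θ) := by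
  have hd : ∀ x, HasFDerivAt (planeFun c₀ α lam θ) (dotL (-(cot α) • dir θ)) x := by
    intro x
    have h1 : HasFDerivAt (fun x => dotL (-(cot α) • dir θ) x - 2 / (c₀ * sin α) * log lam)
        (dotL (-(cot α) • dir θ)) x := (dotL (-(cot α) • dir θ)).hasFDerivAt.sub_const _
    refine h1.congr_of_eventuallyEq (Eventually.of_forall fun y => ?_)
    simp only [planeFun, dotL_apply, inner_smul_left, real_inner_comm]
    simp
  have hC : ContDiff ℝ 2 (planeFun c₀ α lam θ) := by
    have : planeFun c₀ α lam θ =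
        fun x => dotL (-(cot α) • dir θ) x - 2 / (c₀ * sin α) * log lam := by
      funext y
      simp only [planeFun, dotL_apply, inner_smul_left, real_inner_comm]
      simp
    rw [this]
    exact (dotL (-(cot α) • dir θ)).contDiff.sub contDiff_const
  refine ⟨hC, fun x => ?_⟩
  have hh : hess (planeFun c₀ α lam θ) x = 0 := by
    have : fderiv ℝ (planeFun c₀ α lam θ) = fun _ => dotL (-(cot α) • dir θ) := by
      funext y; exact (hd y).fderiv
    ext i j
    simp [hess, this]
  rw [gradient_eq_of_hasFDerivAt (hd x), hh]
  -- The slope `cot α` is the one for which `c / √(1 + |p|²) = c₀`.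
  have hn : √(1 + ‖-(cot α) • dir θ‖ ^ 2) = 1 / sin α := by
    have : 1 + ‖-(cot α) • dir θ‖ ^ 2 = (1 / sin α) ^ 2 := by
      rw [norm_smul, norm_dir, mul_one, Real.norm_eq_abs, sq_abs, neg_sq, cot_eq_cos_div_sin]
      field_simp
      linarith [cos_sq_add_sin_sq α]
    rw [this, Real.sqrt_sq (by positivity)]
  simp only [hamiltonian, hn]
  simp
  field_simp
  ring

/-! ### Geometry of sectors -/

theorem inner_dir (a b : ℝ) : inner ℝ (dir a) (dir b) = cos (a - b) := by
  rw [inner_plane, cos_sub]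
  simp [dir]

theorem continuous_dir : Continuous dir := by
  unfold dir
  refine (PiLp.continuous_toLp 2 _).comp (continuous_pi fun i => ?_)
  fin_cases i
  · exact continuous_cos
  · exact continuous_sin

theorem dir_add_two_pi (a : ℝ) : dir (a + 2 * π) = dir a := by simp [dir]

theorem dir_ne_zero (a : ℝ) : dir a ≠ 0 := by
  rw [← norm_ne_zero_iff, norm_dir]; exact one_ne_zero

theorem dir_injOn {a b : ℝ} (h : dir a = dir b) (h1 : -(2 * π) < a - b) (h2 : a - b < 2 * π) :
    a = b := by
  have h3 : cos (a - b) = 1 := by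
    rw [← inner_dir, h, inner_dir, sub_self, cos_zero]
  have := (Real.cos_eq_one_iff_of_lt_of_lt h1 h2).1 h3
  linarith

theorem exists_polar (a : ℝ) (x : Plane) : ∃ φ ∈ Ico a (a + 2 * π), x = ‖x‖ • dir φ := by
  set z : ℂ := ⟨x 0, x 1⟩ with hz
  have hnz : ‖z‖ = ‖x‖ := by
    have h1 : ‖z‖ ^ 2 = ‖x‖ ^ 2 := by
      rw [norm_sq_plane, Complex.sq_norm, Complex.normSq_apply]
      simp [hz]
      ring
    exact (pow_left_inj₀ (norm_nonneg _) (norm_nonneg _) two_ne_zero).1 h1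
  refine ⟨toIcoMod two_pi_pos a z.arg, toIcoMod_mem_Ico _ _ _, ?_⟩
  have hper : dir (toIcoMod two_pi_pos a z.arg) = dir z.arg := by
    rw [← self_sub_toIcoDiv_zsmul]
    simp only [dir, zsmul_eq_mul]
    rw [Real.cos_sub_int_mul_two_pi, Real.sin_sub_int_mul_two_pi]
  rw [hper]
  have h1 := Complex.norm_mul_cos_arg z
  have h2 := Complex.norm_mul_sin_arg z
  rw [hnz] at h1 h2
  ext i
  fin_cases i
  · simpa [dir, hz] using h1.symm
  · simpa [dir, hz] using h2.symm

section Sector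

variable {θ₁ θ₂ : ℝ}

theorem zero_notMem_sector : (0 : Plane) ∉ sector θ₁ θ₂ := by
  rintro ⟨r, hr, θ, -, h⟩
  rcases smul_eq_zero.1 h.symm with h | h
  · exact hr.ne' h
  · exact dir_ne_zero _ h

theorem norm_smul_dir {r : ℝ} (hr : 0 ≤ r) (θ : ℝ) : ‖r • dir θ‖ = r := by
  rw [norm_smul, norm_dir, mul_one, Real.norm_of_nonneg hr]

theorem exists_of_mem_sector {x : Plane} (hx : x ∈ sector θ₁ θ₂) :
    ∃ θ ∈ Ioo θ₁ θ₂, x = ‖x‖ • dir θ := by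
  obtain ⟨r, hr, θ, hθ, rfl⟩ := hx
  exact ⟨θ, hθ, by rw [norm_smul_dir hr.le]⟩

theorem exists_of_notMem_sector (h2 : θ₂ < θ₁ + 2 * π) {x : Plane}
    (hx : x ∉ sector θ₁ θ₂) : ∃ φ ∈ Icc θ₂ (θ₁ + 2 * π), x = ‖x‖ • dir φ := by
  by_cases hx0 : x = 0
  · exact ⟨θ₂, ⟨le_rfl, h2.le⟩, by simp [hx0]⟩
  obtain ⟨φ, hφ, hxφ⟩ := exists_polar θ₁ x
  rcases hφ.1.eq_or_lt with h | h
  · refine ⟨θ₁ + 2 * π, ⟨h2.le, le_rfl⟩, ?_⟩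
    rw [dir_add_two_pi, h]
    exact hxφ
  · refine ⟨φ, ⟨?_, hφ.2.le⟩, hxφ⟩
    by_contra hlt
    exact hx ⟨‖x‖, norm_pos_iff.2 hx0, φ, ⟨h, not_le.1 hlt⟩, hxφ⟩

theorem isClosed_dir_image (a b : ℝ) : IsClosed (dir '' Icc a b) :=
  (isCompact_Icc.image continuous_dir).isClosed

theorem continuousOn_normalize : ContinuousOn (fun x : Plane => ‖x‖⁻¹ • x) {x | x ≠ 0} := by
  refine ContinuousOn.smul (ContinuousOn.inv₀ continuous_norm.continuousOn ?_) continuousOn_id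
  exact fun x hx => norm_ne_zero_iff.2 hx

theorem normalize_smul_dir {r : ℝ} (hr : 0 < r) (θ : ℝ) :
    ‖r • dir θ‖⁻¹ • (r • dir θ) = dir θ := by
  rw [norm_smul_dir hr.le, smul_smul, inv_mul_cancel₀ hr.ne', one_smul]

/-- This form yields openness: after normalization, the sector is what avoids the compact
complementary arc. -/
theorem sector_eq (h2 : θ₂ < θ₁ + 2 * π) :
    sector θ₁ θ₂ =
      {x | x ≠ 0} ∩ (fun x : Plane => ‖x‖⁻¹ • x) ⁻¹' (dir '' Icc θ₂ (θ₁ + 2 * π))ᶜ := by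
  ext x
  constructor
  · intro hx
    refine ⟨fun h => zero_notMem_sector (h ▸ hx), ?_⟩
    obtain ⟨r, hr, θ, hθ, rfl⟩ := hx
    rintro ⟨φ, hφ, h⟩
    simp only [normalize_smul_dir hr] at h
    have := dir_injOn h (by linarith [hθ.2, hφ.1, pi_pos]) (by linarith [hθ.1, hφ.2])
    linarith [hθ.2, hφ.1]
  · rintro ⟨hx0, hx⟩
    by_contra hxS
    obtain ⟨φ, hφ, h⟩ := exists_of_notMem_sector h2 hxS
    refine hx ⟨φ, hφ, ?_⟩
    have hpos : 0 < ‖x‖ := norm_pos_iff.2 hx0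
    rw [← normalize_smul_dir hpos φ, ← h]

theorem isOpen_sector (h2 : θ₂ < θ₁ + 2 * π) : IsOpen (sector θ₁ θ₂) := by
  rw [sector_eq h2]
  exact continuousOn_normalize.isOpen_inter_preimage isOpen_ne (isClosed_dir_image _ _).isOpen_compl

theorem eq_smul_dir_of_mem_closure_sector {z : Plane} (hz : z ∈ closure (sector θ₁ θ₂))
    (hzS : z ∉ sector θ₁ θ₂) (h0 : z ≠ 0) : z = ‖z‖ • dir θ₁ ∨ z = ‖z‖ • dir θ₂ := by
  have hpos : 0 < ‖z‖ := norm_pos_iff.2 h0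
  have hcont : ContinuousWithinAt (fun x : Plane => ‖x‖⁻¹ • x) (sector θ₁ θ₂) z :=
    (continuousOn_normalize.continuousAt (isOpen_ne.mem_nhds h0)).continuousWithinAt
  have hmem : ‖z‖⁻¹ • z ∈ dir '' Icc θ₁ θ₂ := by
    rw [← (isClosed_dir_image θ₁ θ₂).closure_eq]
    refine hcont.mem_closure hz ?_
    rintro x ⟨r, hr, θ, hθ, rfl⟩
    exact ⟨θ, Ioo_subset_Icc_self hθ, (normalize_smul_dir hr θ).symm⟩
  obtain ⟨θ, hθ, h⟩ := hmem
  have hzθ : z = ‖z‖ • dir θ := by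
    rw [h, smul_smul, mul_inv_cancel₀ hpos.ne', one_smul]
  rcases hθ.1.eq_or_lt with h1 | h1
  · left; rw [h1]; exact hzθ
  rcases hθ.2.eq_or_lt with h2 | h2
  · right; rw [← h2]; exact hzθ
  · exact absurd ⟨‖z‖, hpos, θ, ⟨h1, h2⟩, hzθ⟩ hzS

/-- Gluing of Lipschitz functions across the boundary of an open set. -/
theorem lipschitz_glue {S : Set Plane} (hS : IsOpen S) {f g F : Plane → ℝ} {K : ℝ}
    (hf : ∀ x y, |f x - f y| ≤ K * ‖x - y‖) (hg : ∀ x y, |g x - g y| ≤ K * ‖x - y‖)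
    (hFf : ∀ x ∈ S, F x = f x) (hFg : ∀ x ∉ S, F x = g x)
    (hfg : ∀ z ∈ closure S, z ∉ S → f z = g z) (x y : Plane) :
    |F x - F y| ≤ K * ‖x - y‖ := by
  have key : ∀ x ∈ S, ∀ y ∉ S, |F x - F y| ≤ K * ‖x - y‖ := by
    intro x hx y hy
    -- The connected segment from `x` to `y` meets the boundary of `S` at some `z`, where `f = g`.
    -- Distances add along the segment, so the constant `K` is not lost.
    obtain ⟨z, hz, hzc, hzS⟩ := isPreconnected_closed_iff.1
      (convex_segment (𝕜 := ℝ) x y).isPreconnected (closure S) Sᶜ isClosed_closure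
      hS.isClosed_compl (fun w _ => by
        by_cases hw : w ∈ S
        · exact Or.inl (subset_closure hw)
        · exact Or.inr hw)
      ⟨x, left_mem_segment ℝ x y, subset_closure hx⟩ ⟨y, right_mem_segment ℝ x y, hy⟩
    have hd := dist_add_dist_of_mem_segment hz
    rw [dist_eq_norm, dist_eq_norm, dist_eq_norm] at hd
    have e : F x - F y = (f x - f z) + (g z - g y) := by
      rw [hFf x hx, hFg y hy, hfg z hzc hzS]; ring
    rw [e]
    calc _ ≤ |f x - f z| + |g z - g y| := abs_add_le _ _
      _ ≤ K * ‖x - z‖ + K * ‖z - y‖ := add_le_add (hf _ _) (hg _ _)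
      _ = K * ‖x - y‖ := by rw [← mul_add, hd]
  by_cases hx : x ∈ S <;> by_cases hy : y ∈ S
  · rw [hFf x hx, hFf y hy]; exact hf x y
  · exact key x hx y hy
  · rw [abs_sub_comm, norm_sub_rev]; exact key y hy x hx
  · rw [hFg x hx, hFg y hy]; exact hg x y

end Sector

/-! ### The arc function -/

section Arc

variable {c₀ α lam θ₁ θ₂ : ℝ} {φc : Plane → ℝ}

theorem planeFun_zero (θ : ℝ) : planeFun c₀ α lam θ 0 = -(2 / (c₀ * sin α)) * log lam := by
  simp [planeFun]

theorem edgeFun_zero :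
    edgeFun c₀ α lam lam θ₁ θ₂ 0 = -(2 / (c₀ * sin α)) * log lam := by
  simp [edgeFun, planeFun_zero]

theorem arcFun_of_mem {x : Plane} (hx : x ∈ sector θ₁ θ₂) :
    arcFun c₀ α lam θ₁ θ₂ φc x = min (φc x) (edgeFun c₀ α lam lam θ₁ θ₂ x) := by
  have h0 : x ≠ 0 := fun h => zero_notMem_sector (h ▸ hx)
  rw [arcFun, if_neg h0, if_pos hx]

theorem arcFun_of_notMem {x : Plane} (hx : x ∉ sector θ₁ θ₂) :
    arcFun c₀ α lam θ₁ θ₂ φc x = edgeFun c₀ α lam lam θ₁ θ₂ x := by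
  by_cases h0 : x = 0
  · rw [arcFun, if_pos h0, h0, edgeFun_zero]
  · rw [arcFun, if_neg h0, if_neg hx]

theorem planeFun_lipschitz (hcot : 0 ≤ cot α) (θ : ℝ) (x y : Plane) :
    |planeFun c₀ α lam θ x - planeFun c₀ α lam θ y| ≤ cot α * ‖x - y‖ := by
  have : planeFun c₀ α lam θ x - planeFun c₀ α lam θ y = -(cot α * inner ℝ (x - y) (dir θ)) := by
    simp only [planeFun, inner_sub_left]; ring
  rw [this, abs_neg, abs_mul, abs_of_nonneg hcot]
  gcongr
  simpa [norm_dir] using abs_real_inner_le_norm (x - y) (dir θ)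

theorem lipschitz_min {f g : Plane → ℝ} {K : ℝ} (hf : ∀ x y, |f x - f y| ≤ K * ‖x - y‖)
    (hg : ∀ x y, |g x - g y| ≤ K * ‖x - y‖) (x y : Plane) :
    |min (f x) (g x) - min (f y) (g y)| ≤ K * ‖x - y‖ :=
  (abs_min_sub_min_le_max _ _ _ _).trans (max_le (hf x y) (hg x y))

/-- On the ray of angle `θᵢ` the plane decreases at the maximal rate `cot α` from the value shared
with `φc` at `0`. Hence it lies below `φc`, and the two formulas agree on the sector's boundary. -/
theorem arcFun_lipschitz (hcot : 0 ≤ cot α) (h2 : θ₂ < θ₁ + 2 * π)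
    (hφ : ∀ x y, |φc x - φc y| ≤ cot α * ‖x - y‖)
    (h0 : φc 0 = -(2 / (c₀ * sin α)) * log lam) (x y : Plane) :
    |arcFun c₀ α lam θ₁ θ₂ φc x - arcFun c₀ α lam θ₁ θ₂ φc y| ≤ cot α * ‖x - y‖ := by
  have hedge : ∀ x y, |edgeFun c₀ α lam lam θ₁ θ₂ x - edgeFun c₀ α lam lam θ₁ θ₂ y|
      ≤ cot α * ‖x - y‖ :=
    lipschitz_min (planeFun_lipschitz hcot θ₁) (planeFun_lipschitz hcot θ₂)
  have hray : ∀ (z : Plane) (θ : ℝ), z = ‖z‖ • dir θ → planeFun c₀ α lam θ z ≤ φc z := by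
    intro z θ hz
    have h1 := (abs_le.1 (hφ z 0)).1
    rw [sub_zero, h0] at h1
    have h3 : inner ℝ z (dir θ) = ‖z‖ := by
      conv_lhs => rw [hz]
      rw [real_inner_smul_left, inner_dir, sub_self, cos_zero, mul_one]
    rw [planeFun, h3]
    linarith
  refine lipschitz_glue (isOpen_sector h2) (lipschitz_min hφ hedge) hedge
    (fun x hx => arcFun_of_mem hx) (fun x hx => arcFun_of_notMem hx) (fun z hzc hzS => ?_) x y
  refine min_eq_right ?_
  by_cases hz : z = 0
  · rw [hz, edgeFun_zero, h0]
  · rcases eq_smul_dir_of_mem_closure_sector hzc hzS hz with h | h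
    · exact (min_le_left _ _).trans (hray z θ₁ h)
    · exact (min_le_right _ _).trans (hray z θ₂ h)

/-- Both planes lie above the arc function everywhere, so contact with the edge, including at the
origin and on the boundary rays, is handled globally. The cone is needed only inside the open
sector. -/
theorem arcFun_isViscositySupersolution (hα : 0 < sin α)
    (h2 : θ₂ < θ₁ + 2 * π) (hcont : Continuous (arcFun c₀ α lam θ₁ θ₂ φc))
    (hφ : IsClassicalSolution c₀ (c₀ / sin α) φc) :
    IsViscositySupersolution c₀ (c₀ / sin α) (arcFun c₀ α lam θ₁ θ₂ φc) := by
  refine ⟨hcont.lowerSemicontinuous, fun ψ x hψ hmin => ?_⟩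
  have hle : ∀ y, arcFun c₀ α lam θ₁ θ₂ φc y ≤ edgeFun c₀ α lam lam θ₁ θ₂ y := by
    intro y
    by_cases hy : y ∈ sector θ₁ θ₂
    · rw [arcFun_of_mem hy]; exact min_le_right _ _
    · rw [arcFun_of_notMem hy]
  have hedge : arcFun c₀ α lam θ₁ θ₂ φc x = edgeFun c₀ α lam lam θ₁ θ₂ x →
      0 ≤ hamiltonian c₀ (c₀ / sin α) (gradient ψ x) (hess ψ x) := by
    intro h
    rcases min_choice (planeFun c₀ α lam θ₁ x) (planeFun c₀ α lam θ₂ x) with hm | hm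
    · exact (isClassicalSolution_planeFun hα lam θ₁).nonneg_of_touching hψ hmin
        (Eventually.of_forall fun y => (hle y).trans (min_le_left _ _)) (h.trans hm)
    · exact (isClassicalSolution_planeFun hα lam θ₂).nonneg_of_touching hψ hmin
        (Eventually.of_forall fun y => (hle y).trans (min_le_right _ _)) (h.trans hm)
  by_cases hx : x ∈ sector θ₁ θ₂
  · rcases min_choice (φc x) (edgeFun c₀ α lam lam θ₁ θ₂ x) with hm | hm
    · refine hφ.nonneg_of_touching hψ hmin ?_ ((arcFun_of_mem hx).trans hm)
      filter_upwards [(isOpen_sector h2).mem_nhds hx] with y hy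
      rw [arcFun_of_mem hy]
      exact min_le_left _ _
    · exact hedge ((arcFun_of_mem hx).trans hm)
  · exact hedge (arcFun_of_notMem hx)

end Arc

/-! ### Laplace asymptotics of the sub-solution -/

theorem continuous_circlePt : Continuous circlePt := continuous_dir.subtype_mk _

/-- The integral of `exp (k x·ν)` along the arc. -/
noncomputable def arcIntegral (k θ₁ θ₂ : ℝ) (x : Plane) : ℝ :=
  ∫ θ in Ioo θ₁ θ₂, exp (k * inner ℝ x (dir θ))

theorem integral_arcMeasure {lam : ℝ} (hlam : 0 ≤ lam) (k θ₁ θ₂ : ℝ) (x : Plane) :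
    ∫ ν : Circle1, exp (k * inner ℝ x (ν : Plane)) ∂(arcMeasure lam θ₁ θ₂) =
      lam * exp (k * inner ℝ x (dir θ₁)) + lam * exp (k * inner ℝ x (dir θ₂))
        + arcIntegral k θ₁ θ₂ x := by
  have hc : Continuous fun ν : Circle1 => exp (k * inner ℝ x (ν : Plane)) := by fun_prop
  have hint : ∀ μ : Measure Circle1, IsFiniteMeasure μ →
      Integrable (fun ν : Circle1 => exp (k * inner ℝ x (ν : Plane))) μ := fun μ _ =>
    hc.integrable_of_hasCompactSupport (HasCompactSupport.of_compactSpace _)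
  have hfin : IsFiniteMeasure ((volume.restrict (Ioo θ₁ θ₂)).map circlePt) :=
    Measure.isFiniteMeasure_map _ _
  have hd : ∀ θ, IsFiniteMeasure (ENNReal.ofReal lam • Measure.dirac (circlePt θ)) := fun θ =>
    Measure.smul_finite _ ENNReal.ofReal_ne_top
  have h1 := hint _ (hd θ₁)
  have h2 := hint _ (hd θ₂)
  have h3 := hint _ hfin
  rw [arcMeasure, integral_add_measure (h1.add_measure h2) h3, integral_add_measure h1 h2,
    integral_smul_measure, integral_smul_measure, integral_dirac, integral_dirac,
    integral_map continuous_circlePt.aemeasurable hc.aestronglyMeasurable]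
  simp [circlePt, arcIntegral, ENNReal.toReal_ofReal hlam]

theorem inner_smul_dir (r φ θ : ℝ) : inner ℝ (r • dir φ) (dir θ) = r * cos (φ - θ) := by
  rw [real_inner_smul_left, inner_dir]

theorem integrableOn_exp_inner (k θ₁ θ₂ : ℝ) (x : Plane) :
    IntegrableOn (fun θ => exp (k * inner ℝ x (dir θ))) (Ioo θ₁ θ₂) := by
  have hc : Continuous fun θ => exp (k * inner ℝ x (dir θ)) := by
    have := continuous_dir
    fun_prop
  exact (hc.integrableOn_Icc (a := θ₁) (b := θ₂)).mono_set Ioo_subset_Icc_self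

theorem arcIntegral_nonneg (k θ₁ θ₂ : ℝ) (x : Plane) : 0 ≤ arcIntegral k θ₁ θ₂ x :=
  integral_nonneg fun _ => (exp_pos _).le

theorem cos_le_max_cos {A B t : ℝ} (hA : 0 ≤ A) (hB : B ≤ 2 * π) (hAt : A ≤ t) (htB : t ≤ B) :
    cos t ≤ max (cos A) (cos B) := by
  rcases le_total t π with h | h
  · exact (cos_le_cos_of_nonneg_of_le_pi hA h hAt).trans (le_max_left _ _)
  · refine le_trans ?_ (le_max_right _ _)
    rw [← cos_two_pi_sub t, ← cos_two_pi_sub B]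
    exact cos_le_cos_of_nonneg_of_le_pi (by linarith) (by linarith) (by linarith)

/-- For these `φ` the differences `φ - θ` stay in `[0, 2π]`, where the cosine decreases and then
increases; the integrand is thus bounded by its values at the ends of the arc. -/
theorem arcIntegral_le_of_outside {k θ₁ θ₂ r φ : ℝ} (hk : 0 ≤ k) (h12 : θ₁ < θ₂) (hr : 0 ≤ r)
    (hφ : φ ∈ Icc θ₂ (θ₁ + 2 * π)) :
    arcIntegral k θ₁ θ₂ (r • dir φ) ≤ (θ₂ - θ₁) *
      (exp (k * inner ℝ (r • dir φ) (dir θ₁)) + exp (k * inner ℝ (r • dir φ) (dir θ₂))) := by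
  set E := exp (k * inner ℝ (r • dir φ) (dir θ₁)) + exp (k * inner ℝ (r • dir φ) (dir θ₂)) with hE
  have hpt : ∀ θ ∈ Ioo θ₁ θ₂, exp (k * inner ℝ (r • dir φ) (dir θ)) ≤ E := by
    intro θ hθ
    have h1 := cos_le_max_cos (A := φ - θ₂) (B := φ - θ₁) (t := φ - θ) (by linarith [hφ.1])
      (by linarith [hφ.2]) (by linarith [hθ.2]) (by linarith [hθ.1])
    simp only [hE, inner_smul_dir]
    rcases le_max_iff.1 h1 with h | h
    · refine le_trans ?_ (le_add_of_nonneg_left (exp_pos _).le)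
      gcongr
    · refine le_trans ?_ (le_add_of_nonneg_right (exp_pos _).le)
      gcongr
  calc arcIntegral k θ₁ θ₂ (r • dir φ) ≤ ∫ _ in Ioo θ₁ θ₂, E :=
        setIntegral_mono_on (integrableOn_exp_inner _ _ _ _)
          (integrableOn_const (by simp)) measurableSet_Ioo hpt
    _ = (θ₂ - θ₁) * E := by
        rw [setIntegral_const, measureReal_def, Real.volume_Ioo,
          ENNReal.toReal_ofReal (by linarith), smul_eq_mul]

/-- The bound `cos s ≤ 1 - 2 s² / π²` requires `|s| ≤ π`. An arc may be longer than a half circle,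
so Gaussians centred at the three peaks `0`, `±2π` are added. -/
theorem exp_mul_cos_le {κ t : ℝ} (hκ : 0 ≤ κ) (ht : |t| ≤ 2 * π) :
    exp (κ * cos t) ≤ exp κ * (exp (-(2 * κ / π ^ 2) * t ^ 2)
      + exp (-(2 * κ / π ^ 2) * (t - 2 * π) ^ 2) + exp (-(2 * κ / π ^ 2) * (t + 2 * π) ^ 2)) := by
  have hbase : ∀ s, |s| ≤ π → exp (κ * cos s) ≤ exp κ * exp (-(2 * κ / π ^ 2) * s ^ 2) := by
    intro s hs
    rw [← Real.exp_add]
    gcongr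
    calc κ * cos s ≤ κ * (1 - 2 / π ^ 2 * s ^ 2) := by
          gcongr
          exact Real.cos_le_one_sub_mul_cos_sq hs
      _ = κ + -(2 * κ / π ^ 2) * s ^ 2 := by ring
  have e0 := exp_pos (-(2 * κ / π ^ 2) * t ^ 2)
  have e1 := exp_pos (-(2 * κ / π ^ 2) * (t - 2 * π) ^ 2)
  have e2 := exp_pos (-(2 * κ / π ^ 2) * (t + 2 * π) ^ 2)
  rw [abs_le] at ht
  rcases le_or_gt |t| π with h | h
  · refine (hbase t h).trans ?_
    gcongr
    linarith
  · rcases lt_abs.1 h with h' | h'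
    · have := hbase (t - 2 * π) (abs_le.2 ⟨by linarith, by linarith [pi_pos]⟩)
      rw [cos_sub_two_pi] at this
      refine this.trans ?_
      gcongr
      linarith
    · have := hbase (t + 2 * π) (abs_le.2 ⟨by linarith [pi_pos], by linarith⟩)
      rw [cos_add_two_pi] at this
      refine this.trans ?_
      gcongr
      linarith

theorem arcIntegral_le_of_inside {k θ₁ θ₂ r φ : ℝ} (hk : 0 < k) (h2 : θ₂ < θ₁ + 2 * π)
    (hr : 0 < r) (hφ : φ ∈ Ioo θ₁ θ₂) :
    arcIntegral k θ₁ θ₂ (r • dir φ) ≤ 3 * √(π ^ 3 / (2 * k)) * (exp (k * r) / √r) := by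
  set b : ℝ := 2 * (k * r) / π ^ 2 with hb
  have hb0 : 0 < b := by positivity
  set g : ℝ → ℝ := fun t => exp (-b * t ^ 2) with hg
  have hgi : Integrable g := integrable_exp_neg_mul_sq hb0
  have hgint : ∫ t, g t = √(π / b) := integral_gaussian b
  set G : ℝ → ℝ := fun θ => exp (k * r) * (g (φ - θ) + g (φ - 2 * π - θ) + g (φ + 2 * π - θ))
    with hG
  have hi : ∀ a, Integrable fun θ => g (a - θ) := fun a => hgi.comp_sub_left a
  have hGi : Integrable G := ((((hi _).add (hi _)).add (hi _)).const_mul _)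
  have hGint : ∫ θ, G θ = exp (k * r) * (3 * √(π / b)) := by
    simp only [hG]
    have hadd : Integrable fun θ => g (φ - θ) + g (φ - 2 * π - θ) := (hi _).add (hi _)
    rw [integral_const_mul, integral_add hadd (hi _), integral_add (hi _) (hi _),
      integral_sub_left_eq_self g volume, integral_sub_left_eq_self g volume,
      integral_sub_left_eq_self g volume, hgint]
    ring
  have hG0 : ∀ θ, 0 ≤ G θ := fun θ => by simp only [hG, hg]; positivity
  have hpt : ∀ θ ∈ Ioo θ₁ θ₂, exp (k * inner ℝ (r • dir φ) (dir θ)) ≤ G θ := by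
    intro θ hθ
    rw [inner_smul_dir, ← mul_assoc]
    have := exp_mul_cos_le (κ := k * r) (t := φ - θ) (by positivity)
      (abs_le.2 ⟨by linarith [hθ.2, hφ.1], by linarith [hθ.1, hφ.2]⟩)
    simp only [hG, hg]
    rw [show φ - 2 * π - θ = φ - θ - 2 * π by ring, show φ + 2 * π - θ = φ - θ + 2 * π by ring]
    exact this
  have hsq : √(π / b) = √(π ^ 3 / (2 * k)) / √r := by
    rw [← Real.sqrt_div (by positivity)]
    congr 1
    simp only [hb]
    field_simp
  calc arcIntegral k θ₁ θ₂ (r • dir φ) ≤ ∫ θ in Ioo θ₁ θ₂, G θ :=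
        setIntegral_mono_on (integrableOn_exp_inner _ _ _ _) hGi.integrableOn
          measurableSet_Ioo hpt
    _ ≤ ∫ θ, G θ := setIntegral_le_integral hGi (Eventually.of_forall hG0)
    _ = _ := by rw [hGint, hsq]; ring

/-- A window of width `d = L / √r` adjacent to `φ` loses only the factor `exp (-k L² / 2)`, because
`r d² = L²`. As `L` is half the opening, the window fits on one side of `φ`, so the bound is uniform
up to the edges. -/
theorem le_arcIntegral_of_inside {k θ₁ θ₂ r φ : ℝ} (hk : 0 < k)
    (hr : 1 ≤ r) (hφ : φ ∈ Ioo θ₁ θ₂) :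
    (θ₂ - θ₁) / 2 * exp (-(k * ((θ₂ - θ₁) / 2) ^ 2 / 2)) * (exp (k * r) / √r) ≤
      arcIntegral k θ₁ θ₂ (r • dir φ) := by
  set L := (θ₂ - θ₁) / 2 with hL
  have hL0 : 0 < L := by have := hφ.1.trans hφ.2; simp only [hL]; linarith
  have hr0 : 0 < r := by linarith
  have hsr : 1 ≤ √r := Real.one_le_sqrt.2 hr
  set d := L / √r with hd
  have hd0 : 0 < d := by positivity
  have hdL : d ≤ L := div_le_self hL0.le hsr
  have hd2 : r * d ^ 2 = L ^ 2 := by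
    rw [hd, div_pow, Real.sq_sqrt hr0.le]; field_simp
  have hstep : ∀ a, Ioo a (a + d) ⊆ Ioo θ₁ θ₂ → (∀ θ ∈ Ioo a (a + d), |φ - θ| ≤ d) →
      L * exp (-(k * L ^ 2 / 2)) * (exp (k * r) / √r) ≤ arcIntegral k θ₁ θ₂ (r • dir φ) := by
    intro a hsub hdist
    have hpt : ∀ θ ∈ Ioo a (a + d), exp (k * r - k * L ^ 2 / 2) ≤
        exp (k * inner ℝ (r • dir φ) (dir θ)) := by
      intro θ hθ
      rw [inner_smul_dir]
      gcongr
      have h1 : 1 - d ^ 2 / 2 ≤ cos (φ - θ) := by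
        have h2 := Real.one_sub_sq_div_two_le_cos (x := φ - θ)
        have h3 : (φ - θ) ^ 2 ≤ d ^ 2 := sq_le_sq' (abs_le.1 (hdist θ hθ)).1 (abs_le.1 (hdist θ hθ)).2
        linarith
      calc k * r - k * L ^ 2 / 2 = k * (r * (1 - d ^ 2 / 2)) := by rw [← hd2]; ring
        _ ≤ k * (r * cos (φ - θ)) := by gcongr
    calc L * exp (-(k * L ^ 2 / 2)) * (exp (k * r) / √r)
        = d * exp (k * r - k * L ^ 2 / 2) := by
          rw [hd, sub_eq_add_neg, Real.exp_add]; ring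
      _ = ∫ _ in Ioo a (a + d), exp (k * r - k * L ^ 2 / 2) := by
          rw [setIntegral_const, measureReal_def, Real.volume_Ioo,
            ENNReal.toReal_ofReal (by linarith), smul_eq_mul]
          ring
      _ ≤ ∫ θ in Ioo a (a + d), exp (k * inner ℝ (r • dir φ) (dir θ)) :=
          setIntegral_mono_on (integrableOn_const (by simp)) (integrableOn_exp_inner _ _ _ _)
            measurableSet_Ioo hpt
      _ ≤ arcIntegral k θ₁ θ₂ (r • dir φ) :=
          setIntegral_mono_set (integrableOn_exp_inner _ _ _ _)
            (Eventually.of_forall fun _ => (exp_pos _).le) hsub.eventuallyLE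
  rcases le_total (φ + L) θ₂ with h | h
  · refine hstep φ (fun θ hθ => ⟨hφ.1.trans hθ.1, by linarith [hθ.2]⟩) fun θ hθ => ?_
    rw [abs_le]; constructor <;> linarith [hθ.1, hθ.2]
  · have hL2 : θ₂ - θ₁ = 2 * L := by simp only [hL]; ring
    refine hstep (φ - d) (fun θ hθ => ⟨by linarith [hθ.1], by linarith [hθ.2, hφ.2]⟩)
      fun θ hθ => ?_
    rw [abs_le]; constructor <;> linarith [hθ.1, hθ.2]

/-! ### Comparison of the arc function with the sub-solution -/

section Compare

variable {c₀ α lam θ₁ θ₂ : ℝ} {φc : Plane → ℝ}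

theorem exp_neg_mul_planeFun (hc₀ : 0 < c₀) (hσ : 0 < sin α) (hlam : 0 < lam) (θ : ℝ) (x : Plane) :
    exp (-(c₀ * sin α / 2) * planeFun c₀ α lam θ x) =
      lam * exp (c₀ * cos α / 2 * inner ℝ x (dir θ)) := by
  have : -(c₀ * sin α / 2) * planeFun c₀ α lam θ x =
      log lam + c₀ * cos α / 2 * inner ℝ x (dir θ) := by
    rw [planeFun, cot_eq_cos_div_sin]
    field_simp
    ring
  rw [this, Real.exp_add, Real.exp_log hlam]

theorem exp_neg_mul_min_bounds {s : ℝ} (hs : 0 ≤ s) (a b : ℝ) :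
    exp (-s * a) ≤ exp (-s * min a b) ∧ exp (-s * b) ≤ exp (-s * min a b) ∧
      exp (-s * min a b) ≤ exp (-s * a) + exp (-s * b) := by
  have h : ∀ {a b : ℝ}, a ≤ b → exp (-s * b) ≤ exp (-s * a) := fun h => by
    refine Real.exp_le_exp.2 ?_
    nlinarith
  refine ⟨h (min_le_left _ _), h (min_le_right _ _), ?_⟩
  rcases min_choice a b with h | h <;> rw [h]
  · exact le_add_of_nonneg_right (exp_pos _).le
  · exact le_add_of_nonneg_left (exp_pos _).le

/-- `exp (-(c₀ sin α / 2) φ_a)` is comparable with the integral defining `φ_*`. -/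
theorem exists_arcFun_comparison (hc₀ : 0 < c₀) (hσ : 0 < sin α) (hγ : 0 < cos α)
    (hlam : 0 < lam) (h12 : θ₁ < θ₂) (h2 : θ₂ < θ₁ + 2 * π) {C : ℝ}
    (hφ : ∀ x, 1 ≤ ‖x‖ → |φc x + cot α * ‖x‖ - 1 / (c₀ * sin α) * log ‖x‖| ≤ C) :
    ∃ M : ℝ, 0 < M ∧ ∀ x : Plane, 1 ≤ ‖x‖ →
      (∫ ν : Circle1, exp (c₀ * cos α / 2 * inner ℝ x (ν : Plane)) ∂(arcMeasure lam θ₁ θ₂)) ≤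
        M * exp (-(c₀ * sin α / 2) * arcFun c₀ α lam θ₁ θ₂ φc x) ∧
      exp (-(c₀ * sin α / 2) * arcFun c₀ α lam θ₁ θ₂ φc x) ≤
        M * ∫ ν : Circle1, exp (c₀ * cos α / 2 * inner ℝ x (ν : Plane)) ∂(arcMeasure lam θ₁ θ₂) := by
  set s := c₀ * sin α / 2 with hs
  have hs0 : 0 < s := by positivity
  set k := c₀ * cos α / 2 with hk
  have hk0 : 0 < k := by positivity
  set m₁ : ℝ := (θ₂ - θ₁) / 2 * exp (-(k * ((θ₂ - θ₁) / 2) ^ 2 / 2)) with hm₁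
  have h21 : 0 < θ₂ - θ₁ := by linarith
  have hm₁0 : 0 < m₁ := by positivity
  set M₁ : ℝ := 3 * √(π ^ 3 / (2 * k)) with hM₁
  have hM₁0 : 0 ≤ M₁ := by positivity
  set N : ℝ := exp (s * C) with hN
  have hN0 : 0 < N := exp_pos _
  -- The summands pay, in order, for the Dirac terms, the arc seen from outside the sector, and the
  -- upper and lower Laplace bounds inside it.
  set M : ℝ := 2 + 2 * ((θ₂ - θ₁) / lam) + M₁ * N + N / m₁ with hM
  have hterm1 : 0 < (θ₂ - θ₁) / lam := by positivity
  have hterm2 : 0 ≤ M₁ * N := by positivity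
  have hterm3 : 0 < N / m₁ := by positivity
  have hM0 : 0 < M := by positivity
  refine ⟨M, hM0, fun x hx => ?_⟩
  rw [integral_arcMeasure hlam.le]
  set E₁ := lam * exp (k * inner ℝ x (dir θ₁)) with hE₁
  set E₂ := lam * exp (k * inner ℝ x (dir θ₂)) with hE₂
  have hE₁0 : 0 < E₁ := by positivity
  have hE₂0 : 0 < E₂ := by positivity
  have hA0 := arcIntegral_nonneg k θ₁ θ₂ x
  have hp₁ := exp_neg_mul_planeFun (θ := θ₁) (x := x) hc₀ hσ hlam
  have hp₂ := exp_neg_mul_planeFun (θ := θ₂) (x := x) hc₀ hσ hlam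
  obtain ⟨b1, b2, b3⟩ := exp_neg_mul_min_bounds hs0.le (planeFun c₀ α lam θ₁ x)
    (planeFun c₀ α lam θ₂ x)
  rw [hp₁] at b1 b3
  rw [hp₂] at b2 b3
  change E₁ ≤ exp (-s * edgeFun c₀ α lam lam θ₁ θ₂ x) at b1
  change E₂ ≤ exp (-s * edgeFun c₀ α lam lam θ₁ θ₂ x) at b2
  change exp (-s * edgeFun c₀ α lam lam θ₁ θ₂ x) ≤ E₁ + E₂ at b3
  by_cases hxS : x ∈ sector θ₁ θ₂
  · rw [arcFun_of_mem hxS]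
    obtain ⟨d1, d2, d3⟩ := exp_neg_mul_min_bounds hs0.le (φc x) (edgeFun c₀ α lam lam θ₁ θ₂ x)
    set J := exp (-s * min (φc x) (edgeFun c₀ α lam lam θ₁ θ₂ x))
    obtain ⟨φ, hφS, hxφ⟩ := exists_of_mem_sector hxS
    have hr0 : 0 < ‖x‖ := by linarith
    have hup := arcIntegral_le_of_inside hk0 h2 hr0 hφS
    have hlo := le_arcIntegral_of_inside hk0 hx hφS
    rw [← hxφ] at hup hlo
    set A := arcIntegral k θ₁ θ₂ x
    set S := exp (k * ‖x‖) / √‖x‖ with hS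
    have hS0 : 0 < S := by positivity
    -- The cone's coefficient `1 / (c₀ sin α)` times `s` is `1 / 2`, which matches the Laplace
    -- factor `1 / √r`.
    have hSlog : S = exp (k * ‖x‖ - log ‖x‖ / 2) := by
      rw [hS, Real.exp_sub, ← Real.log_sqrt hr0.le, Real.exp_log (Real.sqrt_pos.2 hr0)]
    have hexp : -s * φc x = (k * ‖x‖ - log ‖x‖ / 2) -
        s * (φc x + cot α * ‖x‖ - 1 / (c₀ * sin α) * log ‖x‖) := by
      rw [cot_eq_cos_div_sin]
      simp only [hs, hk]
      field_simp
      ring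
    obtain ⟨hbl, hbu⟩ := abs_le.1 (hφ x hx)
    generalize φc x + cot α * ‖x‖ - 1 / (c₀ * sin α) * log ‖x‖ = X at hexp hbl hbu
    have hXu : s * X ≤ s * C := mul_le_mul_of_nonneg_left hbu hs0.le
    have hXl : s * -C ≤ s * X := mul_le_mul_of_nonneg_left hbl hs0.le
    have hEc1 : exp (-s * φc x) ≤ N * S := by
      rw [hSlog, hN, ← Real.exp_add, hexp]
      exact Real.exp_le_exp.2 (by linarith only [hXl])
    have hEc2 : S ≤ N * exp (-s * φc x) := by
      rw [hSlog, hN, ← Real.exp_add, hexp]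
      exact Real.exp_le_exp.2 (by linarith only [hXu])
    have hSJ : S ≤ N * J := hEc2.trans (by gcongr)
    have hA1 : A ≤ M₁ * N * J := by
      calc A ≤ M₁ * S := hup
        _ ≤ M₁ * (N * J) := by gcongr
        _ = M₁ * N * J := by ring
    have hJ0 : 0 < J := exp_pos _
    have hEcA : exp (-s * φc x) ≤ N / m₁ * A := by
      calc _ ≤ N * S := hEc1
        _ = N / m₁ * (m₁ * S) := by field_simp
        _ ≤ N / m₁ * A := by gcongr
    constructor
    · have h1 : M * J = 2 * J + M₁ * N * J + (2 * ((θ₂ - θ₁) / lam) + N / m₁) * J := by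
        rw [hM]; ring
      have h3 : 0 ≤ (2 * ((θ₂ - θ₁) / lam) + N / m₁) * J := by positivity
      linarith
    · have h1 : M * (E₁ + E₂ + A) = (E₁ + E₂) + N / m₁ * A +
          ((1 + 2 * ((θ₂ - θ₁) / lam) + M₁ * N) * (E₁ + E₂ + A) + N / m₁ * (E₁ + E₂) + A) := by
        rw [hM]; ring
      have h3 : 0 ≤ (1 + 2 * ((θ₂ - θ₁) / lam) + M₁ * N) * (E₁ + E₂ + A) + N / m₁ * (E₁ + E₂) + A := by
        positivity
      linarith
  · rw [arcFun_of_notMem hxS]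
    set J := exp (-s * edgeFun c₀ α lam lam θ₁ θ₂ x)
    have hJ0 : 0 < J := exp_pos _
    obtain ⟨φ, hφS, hxφ⟩ := exists_of_notMem_sector h2 hxS
    have hup := arcIntegral_le_of_outside hk0.le h12 (norm_nonneg x) hφS
    rw [← hxφ] at hup
    set A := arcIntegral k θ₁ θ₂ x
    have hA1 : A ≤ (θ₂ - θ₁) / lam * (E₁ + E₂) := by
      refine hup.trans (le_of_eq ?_)
      simp only [hE₁, hE₂]
      field_simp
    have hA2 : A ≤ (θ₂ - θ₁) / lam * (2 * J) := hA1.trans (by gcongr; linarith)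
    constructor
    · have h1 : M * J = 2 * J + (θ₂ - θ₁) / lam * (2 * J) + (M₁ * N + N / m₁) * J := by
        rw [hM]; ring
      have h3 : 0 ≤ (M₁ * N + N / m₁) * J := by positivity
      linarith
    · have h1 : M * (E₁ + E₂ + A) = (E₁ + E₂) +
          ((1 + 2 * ((θ₂ - θ₁) / lam) + M₁ * N + N / m₁) * (E₁ + E₂ + A) + A) := by
        rw [hM]; ring
      have h3 : 0 ≤ (1 + 2 * ((θ₂ - θ₁) / lam) + M₁ * N + N / m₁) * (E₁ + E₂ + A) + A := by
        positivity
      linarith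

theorem arcFun_sub_subSol_isBigO (hc₀ : 0 < c₀) (hσ : 0 < sin α) (hγ : 0 < cos α)
    (hlam : 0 < lam) (h12 : θ₁ < θ₂) (h2 : θ₂ < θ₁ + 2 * π) {C : ℝ}
    (hφ : ∀ x, 1 ≤ ‖x‖ → |φc x + cot α * ‖x‖ - 1 / (c₀ * sin α) * log ‖x‖| ≤ C) :
    (fun x => arcFun c₀ α lam θ₁ θ₂ φc x - subSol c₀ α (arcMeasure lam θ₁ θ₂) x)
      =O[Bornology.cobounded Plane] fun _ => (1 : ℝ) := by
  obtain ⟨M, hM, hcomp⟩ := exists_arcFun_comparison hc₀ hσ hγ hlam h12 h2 hφ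
  refine IsBigO.of_bound (2 / (c₀ * sin α) * |log M|) ?_
  filter_upwards [tendsto_norm_cobounded_atTop.eventually_ge_atTop 1] with x hx
  obtain ⟨h1, h3⟩ := hcomp x hx
  rw [subSol]
  set I := ∫ ν : Circle1, exp (c₀ * cos α / 2 * inner ℝ x (ν : Plane)) ∂(arcMeasure lam θ₁ θ₂)
  set a := arcFun c₀ α lam θ₁ θ₂ φc x
  have hJ := exp_pos (-(c₀ * sin α / 2) * a)
  have hI : 0 < I := by
    by_contra hneg
    have := mul_nonpos_of_nonneg_of_nonpos hM.le (not_lt.1 hneg)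
    linarith
  have l1 := Real.log_le_log hI h1
  have l2 := Real.log_le_log hJ h3
  rw [Real.log_mul hM.ne' hJ.ne', Real.log_exp] at l1
  rw [Real.log_mul hM.ne' hI.ne', Real.log_exp] at l2
  have e : a - -(2 / (c₀ * sin α)) * log I =
      2 / (c₀ * sin α) * (log I + c₀ * sin α / 2 * a) := by
    field_simp
    ring
  rw [e, norm_one, mul_one, Real.norm_eq_abs, abs_mul, abs_of_pos (by positivity)]
  refine mul_le_mul_of_nonneg_left ?_ (by positivity)
  have := le_abs_self (log M)
  rw [abs_le]
  constructor <;> linarith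

theorem arcFun_sub_subSol_isBigO_of_cos_eq_zero (hγ : cos α = 0)
    (hφ : ∀ x, φc x = -(2 / (c₀ * sin α)) * log lam) :
    (fun x => arcFun c₀ α lam θ₁ θ₂ φc x - subSol c₀ α (arcMeasure lam θ₁ θ₂) x)
      =O[Bornology.cobounded Plane] fun _ => (1 : ℝ) := by
  have hcot : cot α = 0 := by rw [cot_eq_cos_div_sin, hγ, zero_div]
  have hedge : ∀ x, edgeFun c₀ α lam lam θ₁ θ₂ x = -(2 / (c₀ * sin α)) * log lam := fun x => by
    simp [edgeFun, planeFun, hcot]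
  have harc : ∀ x, arcFun c₀ α lam θ₁ θ₂ φc x = -(2 / (c₀ * sin α)) * log lam := fun x => by
    simp [arcFun, hφ, hedge]
  simp only [harc, subSol, hγ, mul_zero, zero_div, zero_mul]
  exact isBigO_const_const _ one_ne_zero _

end Compare

end ForcedMCM

theorem lemma7p4 (c₀ α lam θ₁ θ₂ : ℝ) (hc₀ : 0 < c₀) (hα : 0 < α) (hα' : α ≤ π / 2)
    (hlam : 0 < lam) (hθ₁ : θ₁ ∈ Ico 0 (2 * π)) (hθ₂ : θ₂ ∈ Ico 0 (2 * π)) (hθ : θ₁ < θ₂) :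
    (∃! φc : Plane → ℝ,
        IsConeSolution c₀ α φc ∧ φc 0 = -(2 / (c₀ * sin α)) * log lam) ∧
    ∀ φc : Plane → ℝ, IsConeSolution c₀ α φc → φc 0 = -(2 / (c₀ * sin α)) * log lam →
      (∃ K : ℝ≥0, LipschitzWith K (arcFun c₀ α lam θ₁ θ₂ φc)) ∧
      IsViscositySupersolution c₀ (c₀ / sin α) (arcFun c₀ α lam θ₁ θ₂ φc) ∧
      (fun x => arcFun c₀ α lam θ₁ θ₂ φc x - subSol c₀ α (arcMeasure lam θ₁ θ₂) x)
        =O[Bornology.cobounded Plane] fun _ => (1 : ℝ) := by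
  have hσ : 0 < sin α := sin_pos_of_pos_of_lt_pi hα (by linarith [pi_pos])
  have hγ : 0 ≤ cos α := cos_nonneg_of_mem_Icc ⟨by linarith, hα'⟩
  have hcot : 0 ≤ cot α := by rw [cot_eq_cos_div_sin]; positivity
  have h2 : θ₂ < θ₁ + 2 * π := by linarith [hθ₁.1, hθ₂.2]
  obtain ⟨φ, hφ, hφ0, hlip, hlog, hconst⟩ :=
    exists_coneSolution hc₀ hα hα' (-(2 / (c₀ * sin α)) * log lam)
  refine ⟨⟨φ, ⟨hφ, hφ0⟩, fun ψ hψ => hψ.1.eq hφ (hψ.2.trans hφ0.symm)⟩, fun ψ hψ hψ0 => ?_⟩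
  -- By uniqueness, an arbitrary cone solution inherits the Lipschitz bound and the expansion of the
  -- constructed one.
  obtain rfl : ψ = φ := hψ.eq hφ (hψ0.trans hφ0.symm)
  have hL : LipschitzWith (Real.toNNReal (cot α)) (arcFun c₀ α lam θ₁ θ₂ ψ) :=
    LipschitzWith.of_dist_le_mul fun x y => by
      rw [Real.dist_eq, dist_eq_norm, Real.coe_toNNReal _ hcot]
      exact arcFun_lipschitz hcot h2 hlip hψ0 x y
  refine ⟨⟨_, hL⟩, arcFun_isViscositySupersolution hσ h2 hL.continuous hψ.solution, ?_⟩
  rcases hα'.eq_or_lt with h | h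
  · exact arcFun_sub_subSol_isBigO_of_cos_eq_zero (by rw [h, cos_pi_div_two]) (hconst h)
  · obtain ⟨C, hC⟩ := hlog h
    exact arcFun_sub_subSol_isBigO hc₀ hσ (cos_pos_of_mem_Ioo ⟨by linarith, h⟩) hlam hθ h2 hC
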